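/- Let $A$ and $B$ be associative unital rings (for example, algebras over a commutative ring $k$), let $\mathfrak{C}$ be an $A$-coring, and let $\Sigma$ be a $B$-$\mathfrak{C}$-bicomodule, i.e. a $B$-$A$-bimodule with a left $B$-linear right $\mathfrak{C}$-coaction $\rho(u)=\sum u_{(0)}\otimes_A u_{(1)}$, such that $\Sigma_A$ is finitely generated projective. Let $\mathcal{M}_B$ be the category of right $B$-modules and $\mathcal{M}^{\mathfrak{C}}$ the category of right $\mathfrak{C}$-comodules. Let $$F=-\otimes_B\Sigma:\mathcal{M}_B\to\mathcal{M}^{\mathfrak{C}},\qquad G=\mathrm{Hom}_{\mathfrak{C}}(\Sigma,-):\mathcal{M}^{\mathfrak{C}}\to\mathcal{M}_B,$$ put $\Sigma^*=\mathrm{Hom}_A(\Sigma,A)$, and let $$\mathsf{can}:\Sigma^*\otimes_B\Sigma\to\mathfrak{C},\ \ \mathsf{can}(f\otimes_B u)=\sum f(u_{(0)})u_{(1)},\qquad \phi:B\to\mathrm{End}_{\mathfrak{C}}(\Sigma),\ \ \phi(b)(u)=bu .$$ Here $\Sigma_{\mathfrak{C}}$ projective (respectively, a generator) means: as an object of $\mathcal{M}^{\mathfrak{C}}$,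 where $U$ is a generator if for every proper subobject $X\hookrightarrow Y$ some morphism $U\to Y$ does not factor through $X$. The module ${}_B\Sigma$ is completely faithful if, for every right $B$-module $X$ and $x\in X$, $x\otimes_B u=0$ for all $u\in\Sigma$ implies $x=0$. The coring $\mathfrak{C}$ is coseparable if its comultiplication $\mathfrak{C}\to\mathfrak{C}\otimes_A\mathfrak{C}$ is a split monomorphism of $\mathfrak{C}$-bicomodules. (I) The following statements are equivalent: 1. $F$ and $G$ are inverse equivalences and ${}_A\mathfrak{C}$ is flat; 2. ${}_B\Sigma$ is flat, $\Sigma_{\mathfrak{C}}$ is projective, and $\mathsf{can}$ and $\phi$ are isomorphisms; 3. ${}_A\mathfrak{C}$ is flat, $\Sigma_{\mathfrak{C}}$ is a projective generator, and $\phi$ is an isomorphism; 4. ${}_B\Sigma$ is faithfully flat and $\mathsf{can}$ is an isomorphism. (II) If moreover $\mathfrak{C}$ is coseparable and ${}_A\mathfrak{C}$ is projective, then the following statements are equivalent: 1. $F$ and $G$ are inverse equivalences; 2. $\Sigma_{\mathfrak{C}}$ is a generator and $\phi$ is an isomorphism; 3. $\phi$ is an isomorphism and $\mathsf{can}$ is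 surjective; 4. ${}_B\Sigma$ is completely faithful and $\mathsf{can}$ is bijective. -/

import Mathlib

open CategoryTheory MulOpposite
open scoped TensorProduct

universe u

/-! Right modules over a (noncommutative) ring `R` are modules over `Rᵐᵒᵖ`: `m * r` is `op r • m`.
An `R`-`S`-bimodule carries `Module R`, `Module Sᵐᵒᵖ` and `SMulCommClass R Sᵐᵒᵖ`. -/

section BalancedTensor

variable (R : Type*) [Ring R]

/-- The subgroup of `M ⊗[ℤ] N` generated by all `m * r ⊗ n - m ⊗ r * n`. -/
def balancedRel (M N : Type*) [AddCommGroup M] [Module Rᵐᵒᵖ M] [AddCommGroup N] [Module R N] :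
    Submodule ℤ (M ⊗[ℤ] N) :=
  Submodule.span ℤ
    {x | ∃ (m : M) (r : R) (n : N), x = (op r • m) ⊗ₜ[ℤ] n - m ⊗ₜ[ℤ] (r • n)}

/-- The tensor product of a right `R`-module `M` and a left `R`-module `N` over the
(noncommutative) ring `R`. -/
def BTensor (M N : Type*) [AddCommGroup M] [Module Rᵐᵒᵖ M] [AddCommGroup N] [Module R N] :
    Type _ :=
  (M ⊗[ℤ] N) ⧸ balancedRel R M N

namespace BTensor

variable {M M' M'' N N' N'' P : Type*}
  [AddCommGroup M] [Module Rᵐᵒᵖ M] [AddCommGroup M'] [Module Rᵐᵒᵖ M']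
  [AddCommGroup M''] [Module Rᵐᵒᵖ M'']
  [AddCommGroup N] [Module R N] [AddCommGroup N'] [Module R N'] [AddCommGroup N''] [Module R N'']
  [AddCommGroup P]

instance : AddCommGroup (BTensor R M N) :=
  inferInstanceAs (AddCommGroup ((M ⊗[ℤ] N) ⧸ balancedRel R M N))

/-- The class of the pure tensor `m ⊗ n`. -/
def tmul (m : M) (n : N) : BTensor R M N :=
  (balancedRel R M N).mkQ (m ⊗ₜ[ℤ] n)

theorem add_tmul (m m' : M) (n : N) : tmul R (m + m') n = tmul R m n + tmul R m' n := by
  unfold tmul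
  rw [TensorProduct.add_tmul, map_add]
  rfl

theorem tmul_add (m : M) (n n' : N) : tmul R m (n + n') = tmul R m n + tmul R m n' := by
  unfold tmul
  rw [TensorProduct.tmul_add, map_add]
  rfl

theorem smul_tmul (r : R) (m : M) (n : N) : tmul R (op r • m) n = tmul R m (r • n) := by
  unfold tmul
  have h : (op r • m) ⊗ₜ[ℤ] n - m ⊗ₜ[ℤ] (r • n) ∈ balancedRel R M N :=
    Submodule.subset_span ⟨m, r, n, rfl⟩
  exact (Submodule.Quotient.eq _).2 h

variable {R}

theorem induction_on {p : BTensor R M N → Prop} (z : BTensor R M N) (h0 : p 0)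
    (ht : ∀ m n, p (tmul R m n)) (ha : ∀ x y, p x → p y → p (x + y)) : p z := by
  obtain ⟨x, rfl⟩ := (balancedRel R M N).mkQ_surjective z
  induction x using TensorProduct.induction_on with
  | zero => rw [map_zero]; exact h0
  | tmul m n => exact ht m n
  | add x y hx hy => rw [map_add]; exact ha _ _ hx hy

/-- The universal property: a biadditive balanced map induces an additive map. -/
def lift (f : M →+ N →+ P) (hf : ∀ (m : M) (r : R) (n : N), f (op r • m) n = f m (r • n)) :
    BTensor R M N →+ P :=
  ((balancedRel R M N).liftQ
    (TensorProduct.liftAddHom f (fun r m n => by simp)).toIntLinearMap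
    (by
      refine Submodule.span_le.2 ?_
      rintro _ ⟨m, r, n, rfl⟩
      simp [hf])).toAddMonoidHom

@[simp] theorem lift_tmul (f : M →+ N →+ P)
    (hf : ∀ (m : M) (r : R) (n : N), f (op r • m) n = f m (r • n)) (m : M) (n : N) :
    lift f hf (tmul R m n) = f m n := by
  rfl

theorem hom_ext {f g : BTensor R M N →+ P} (h : ∀ m n, f (tmul R m n) = g (tmul R m n)) :
    f = g := by
  ext z
  induction z using induction_on with
  | h0 => simp
  | ht m n => exact h m n
  | ha x y hx hy => rw [map_add, map_add, hx, hy]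

/-- The additive map `m ⊗ n ↦ f m ⊗ g n`. -/
def map (f : M →ₗ[Rᵐᵒᵖ] M') (g : N →ₗ[R] N') : BTensor R M N →+ BTensor R M' N' :=
  lift
    (AddMonoidHom.mk' (fun m => AddMonoidHom.mk' (fun n => tmul R (f m) (g n))
        (fun a b => by rw [map_add, tmul_add]))
      (fun a b => by ext n; simp [add_tmul]))
    (fun m r n => by simp [smul_tmul])

@[simp] theorem map_tmul (f : M →ₗ[Rᵐᵒᵖ] M') (g : N →ₗ[R] N') (m : M) (n : N) :
    map f g (tmul R m n) = tmul R (f m) (g n) := by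
  simp [map]

theorem map_map (f : M →ₗ[Rᵐᵒᵖ] M') (g : N →ₗ[R] N') (f' : M' →ₗ[Rᵐᵒᵖ] M'') (g' : N' →ₗ[R] N'')
    (z : BTensor R M N) : map f' g' (map f g z) = map (f'.comp f) (g'.comp g) z := by
  induction z using induction_on with
  | h0 => simp
  | ht m n => simp
  | ha x y hx hy => simp only [map_add, hx, hy]

theorem map_id_id (z : BTensor R M N) : map (LinearMap.id) (LinearMap.id) z = z := by
  induction z using induction_on with
  | h0 => simp
  | ht m n => simp
  | ha x y hx hy => simp only [map_add, hx, hy]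

theorem map_add_left (f f' : M →ₗ[Rᵐᵒᵖ] M') (g : N →ₗ[R] N') (z : BTensor R M N) :
    map (f + f') g z = map f g z + map f' g z := by
  induction z using induction_on with
  | h0 => simp
  | ht m n => simp [add_tmul]
  | ha x y hx hy => simp only [map_add, hx, hy]; abel

section Actions

variable {S T : Type*} [Ring S] [Ring T] [Module S M] [SMulCommClass S Rᵐᵒᵖ M]
  [Module S M'] [SMulCommClass S Rᵐᵒᵖ M']
  [Module Tᵐᵒᵖ N] [SMulCommClass R Tᵐᵒᵖ N] [Module Tᵐᵒᵖ N'] [SMulCommClass R Tᵐᵒᵖ N']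

/-- Left multiplication by `s` on an `S`-`R`-bimodule, as a right `R`-linear map. -/
def lmul (M : Type*) [AddCommGroup M] [Module Rᵐᵒᵖ M] [Module S M] [SMulCommClass S Rᵐᵒᵖ M]
    (s : S) : M →ₗ[Rᵐᵒᵖ] M where
  toFun m := s • m
  map_add' := smul_add s
  map_smul' r m := smul_comm s r m

/-- Right multiplication by `t` on an `R`-`T`-bimodule, as a left `R`-linear map. -/
def rmul (N : Type*) [AddCommGroup N] [Module R N] [Module Tᵐᵒᵖ N] [SMulCommClass R Tᵐᵒᵖ N]
    (t : Tᵐᵒᵖ) : N →ₗ[R] N where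
  toFun n := t • n
  map_add' := smul_add t
  map_smul' r n := (smul_comm r t n).symm

@[simp] theorem lmul_apply (s : S) (m : M) : lmul (R := R) M s m = s • m := rfl
@[simp] theorem rmul_apply (t : Tᵐᵒᵖ) (n : N) : rmul (R := R) N t n = t • n := rfl

/-- The left action `s * (m ⊗ n) = (s * m) ⊗ n`. -/
instance (priority := low) leftModule : Module S (BTensor R M N) where
  smul s z := map (lmul M s) LinearMap.id z
  one_smul z := by
    change map (lmul M (1 : S)) LinearMap.id z = z
    rw [show lmul (R := R) M (1 : S) = LinearMap.id by ext; simp, map_id_id]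
  mul_smul s s' z := by
    change map (lmul M (s * s')) LinearMap.id z =
      map (lmul M s) LinearMap.id (map (lmul M s') LinearMap.id z)
    rw [map_map]
    congr 1
    congr 1
    ext m
    simp [mul_smul]
  smul_zero s := map_zero _
  smul_add s := map_add _
  add_smul s s' z := by
    change map (lmul M (s + s')) LinearMap.id z =
      map (lmul M s) LinearMap.id z + map (lmul M s') LinearMap.id z
    rw [← map_add_left]
    congr 1
    congr 1
    ext m
    simp [add_smul]
  zero_smul z := by
    change map (lmul M (0 : S)) LinearMap.id z = 0
    induction z using induction_on with
    | h0 => simp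
    | ht m n =>
      have h := add_tmul R (0 : M) 0 n
      simpa using h
    | ha x y hx hy => rw [map_add, hx, hy, add_zero]

theorem smul_def (s : S) (z : BTensor R M N) : s • z = map (lmul M s) LinearMap.id z := rfl

@[simp] theorem smul_tmul_left (s : S) (m : M) (n : N) :
    s • tmul R m n = tmul R (s • m) n := by
  rw [smul_def, map_tmul]; rfl

/-- The right action `(m ⊗ n) * t = m ⊗ (n * t)`. -/
instance (priority := low) rightModule : Module Tᵐᵒᵖ (BTensor R M N) where
  smul t z := map LinearMap.id (rmul N t) z
  one_smul z := by
    change map LinearMap.id (rmul N (1 : Tᵐᵒᵖ)) z = z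
    rw [show rmul (R := R) N (1 : Tᵐᵒᵖ) = LinearMap.id by ext; simp, map_id_id]
  mul_smul s s' z := by
    change map LinearMap.id (rmul N (s * s')) z =
      map LinearMap.id (rmul N s) (map LinearMap.id (rmul N s') z)
    rw [map_map]
    congr 1
    congr 1
    ext m
    simp [mul_smul]
  smul_zero s := map_zero _
  smul_add s := map_add _
  add_smul s s' z := by
    change map LinearMap.id (rmul N (s + s')) z =
      map LinearMap.id (rmul N s) z + map LinearMap.id (rmul N s') z
    induction z using induction_on with
    | h0 => simp
    | ht m n => simp [add_smul, tmul_add]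
    | ha x y hx hy => simp only [map_add, hx, hy]; abel
  zero_smul z := by
    change map LinearMap.id (rmul N (0 : Tᵐᵒᵖ)) z = 0
    induction z using induction_on with
    | h0 => simp
    | ht m n =>
      have h := tmul_add R m (0 : N) 0
      simpa using h
    | ha x y hx hy => rw [map_add, hx, hy, add_zero]

theorem op_smul_def (t : Tᵐᵒᵖ) (z : BTensor R M N) : t • z = map LinearMap.id (rmul N t) z := rfl

@[simp] theorem op_smul_tmul (t : Tᵐᵒᵖ) (m : M) (n : N) :
    t • tmul R m n = tmul R m (t • n) := by
  rw [op_smul_def, map_tmul]; rfl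

instance (priority := low) bimodule : SMulCommClass S Tᵐᵒᵖ (BTensor R M N) where
  smul_comm s t z := by
    simp only [smul_def, op_smul_def, map_map]
    rfl

theorem map_op_smul (f : M →ₗ[Rᵐᵒᵖ] M') (t : Tᵐᵒᵖ) (z : BTensor R M N) :
    map f LinearMap.id (t • z) = t • map f LinearMap.id z := by
  simp only [op_smul_def, map_map]
  rfl

/-- `f ⊗ N` as a map of right `T`-modules. -/
def mapRight (f : M →ₗ[Rᵐᵒᵖ] M') : BTensor R M N →ₗ[Tᵐᵒᵖ] BTensor R M' N where
  toFun := map f LinearMap.id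
  map_add' := map_add _
  map_smul' := map_op_smul f

/-- The right `T`-linear map `n ↦ m ⊗ n`. -/
def tmulHom (m : M) : N →ₗ[Tᵐᵒᵖ] BTensor R M N where
  toFun n := tmul R m n
  map_add' := tmul_add R m
  map_smul' t n := (op_smul_tmul t m n).symm

@[simp] theorem tmulHom_apply (m : M) (n : N) : tmulHom (T := T) m n = tmul R m n := rfl

@[simp] theorem mapRight_apply (f : M →ₗ[Rᵐᵒᵖ] M') (z : BTensor R M N) :
    mapRight (T := T) f z = map f LinearMap.id z := rfl

/-- The left `R`-linear map `n ↦ n ⊗ q`. -/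
def tmulFlip {Q : Type*} [AddCommGroup Q] [Module T Q] (q : Q) : N →ₗ[R] BTensor T N Q where
  toFun n := tmul T n q
  map_add' a b := add_tmul T a b q
  map_smul' r n := (smul_tmul_left r n q).symm

@[simp] theorem tmulFlip_apply {Q : Type*} [AddCommGroup Q] [Module T Q] (q : Q) (n : N) :
    tmulFlip (R := R) (T := T) q n = tmul T n q := rfl

/-- The canonical associativity isomorphism `(M ⊗ N) ⊗ Q → M ⊗ (N ⊗ Q)`,
`(m ⊗ n) ⊗ q ↦ m ⊗ (n ⊗ q)`. -/
def assoc {Q : Type*} [AddCommGroup Q] [Module T Q] :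
    BTensor T (BTensor R M N) Q →+ BTensor R M (BTensor T N Q) :=
  lift
    (AddMonoidHom.mk' (fun z => AddMonoidHom.mk'
        (fun q => map LinearMap.id (tmulFlip (T := T) q) z)
        (fun a b => by
          induction z using induction_on with
          | h0 => simp
          | ht m n => simp [tmul_add]
          | ha x y hx hy => simp only [map_add, hx, hy]; abel))
      (fun a b => by ext q; simp))
    (fun z t q => by
      have h : (tmulFlip (R := R) (N := N) (T := T) q).comp (rmul N (op t)) =
          tmulFlip (t • q) := by
        ext n; simp [smul_tmul]
      simp [op_smul_def, map_map, h])

@[simp] theorem assoc_tmul {Q : Type*} [AddCommGroup Q] [Module T Q] (m : M) (n : N) (q : Q) :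
    assoc (tmul T (tmul R m n) q) = tmul R m (tmul T n q) := by
  simp [assoc]

/-- The inverse of `assoc`. -/
def assocInv {Q : Type*} [AddCommGroup Q] [Module T Q] :
    BTensor R M (BTensor T N Q) →+ BTensor T (BTensor R M N) Q :=
  lift
    (AddMonoidHom.mk' (fun m => map (tmulHom (T := T) m) LinearMap.id)
      (fun a b => by
        apply hom_ext
        intro n q
        simp [add_tmul]))
    (fun m r z => by
      induction z using induction_on with
      | h0 => simp
      | ht n q => simp [smul_tmul]
      | ha x y hx hy => simp only [smul_add, map_add, hx, hy])

theorem assocInv_assoc {Q : Type*} [AddCommGroup Q] [Module T Q]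
    (z : BTensor T (BTensor R M N) Q) : assocInv (assoc z) = z := by
  induction z using induction_on with
  | h0 => simp
  | ht w q =>
    induction w using induction_on with
    | h0 =>
      have h : tmul T (0 : BTensor R M N) q = 0 := by
        simpa using add_tmul T (0 : BTensor R M N) 0 q
      simp [h]
    | ht m n => simp [assocInv]
    | ha x y hx hy => rw [add_tmul, map_add, map_add, hx, hy]
  | ha x y hx hy => rw [map_add, map_add, hx, hy]

theorem assoc_map {Q : Type*} [AddCommGroup Q] [Module T Q] (f : M →ₗ[Rᵐᵒᵖ] M')
    (z : BTensor T (BTensor R M N) Q) :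
    assoc (map (mapRight f) LinearMap.id z) = map f LinearMap.id (assoc z) := by
  induction z using induction_on with
  | h0 => simp
  | ht w q =>
    induction w using induction_on with
    | h0 =>
      have h : tmul T (0 : BTensor R M N) q = 0 := by
        simpa using add_tmul T (0 : BTensor R M N) 0 q
      simp [h]
    | ht m n => simp
    | ha x y hx hy => simp only [add_tmul, map_add, hx, hy]
  | ha x y hx hy => simp only [map_add, hx, hy]

end Actions

/-- The canonical isomorphism `M ⊗ R → M`, `m ⊗ r ↦ m * r`. -/
def rid : BTensor R M R →+ M :=
  lift
    (AddMonoidHom.mk' (fun m => AddMonoidHom.mk' (fun r => op r • m)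
        (fun a b => by rw [MulOpposite.op_add, add_smul]))
      (fun a b => by ext n; simp))
    (fun m r n => by simp [mul_smul])

/-- The canonical isomorphism `R ⊗ N → N`, `r ⊗ n ↦ r * n`. -/
def lid : BTensor R R N →+ N :=
  lift
    (AddMonoidHom.mk' (fun r => AddMonoidHom.mk' (fun n => r • n) (smul_add r))
      (fun a b => by ext n; simp [add_smul]))
    (fun m r n => by simp [mul_smul])

@[simp] theorem rid_tmul (m : M) (r : R) : rid (tmul R m r) = op r • m := by simp [rid]

@[simp] theorem lid_tmul (r : R) (n : N) : lid (tmul R r n) = r • n := by simp [lid]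

theorem rid_map (f : M →ₗ[Rᵐᵒᵖ] M') (z : BTensor R M R) :
    rid (map f LinearMap.id z) = f (rid z) := by
  induction z using induction_on with
  | h0 => simp
  | ht m r => simp
  | ha x y hx hy => simp only [map_add, hx, hy]

end BTensor

end BalancedTensor

/-- Homomorphisms of `S`-`T`-bimodules. -/
structure BimodHom (S T M N : Type*) [Ring S] [Ring T] [AddCommGroup M] [Module S M]
    [Module Tᵐᵒᵖ M] [AddCommGroup N] [Module S N] [Module Tᵐᵒᵖ N] where
  /-- the map, as a left linear map -/
  left : M →ₗ[S] N
  map_op_smul : ∀ (t : Tᵐᵒᵖ) (m : M), left (t • m) = t • left m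

/-- A bimodule map as a right linear map. -/
def BimodHom.right {S T M N : Type*} [Ring S] [Ring T] [AddCommGroup M] [Module S M]
    [Module Tᵐᵒᵖ M] [AddCommGroup N] [Module S N] [Module Tᵐᵒᵖ N] (f : BimodHom S T M N) :
    M →ₗ[Tᵐᵒᵖ] N where
  toFun := f.left
  map_add' := map_add _
  map_smul' := f.map_op_smul

/-- An `A`-coring structure on the `A`-bimodule `C`. -/
class Coring (A C : Type*) [Ring A] [AddCommGroup C] [Module A C] [Module Aᵐᵒᵖ C]
    [SMulCommClass A Aᵐᵒᵖ C] where
  /-- comultiplication -/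
  comul : BimodHom A A C (BTensor A C C)
  /-- counit -/
  counit : BimodHom A A C A
  coassoc : ∀ c : C, BTensor.assoc (BTensor.map comul.right LinearMap.id (comul.left c)) =
    BTensor.map LinearMap.id comul.left (comul.left c)
  counit_left : ∀ c : C, BTensor.lid (BTensor.map counit.right LinearMap.id (comul.left c)) = c
  counit_right : ∀ c : C, BTensor.rid (BTensor.map LinearMap.id counit.left (comul.left c)) = c

/-- A right comodule structure over the `A`-coring `C` on the right `A`-module `M`. -/
class Comodule (A C M : Type*) [Ring A] [AddCommGroup C] [Module A C] [Module Aᵐᵒᵖ C]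
    [SMulCommClass A Aᵐᵒᵖ C] [Coring A C] [AddCommGroup M] [Module Aᵐᵒᵖ M] where
  /-- the coaction -/
  coact : M →ₗ[Aᵐᵒᵖ] BTensor A M C
  coassoc : ∀ m : M, BTensor.assoc (BTensor.map coact LinearMap.id (coact m)) =
    BTensor.map LinearMap.id (Coring.comul (A := A) (C := C)).left (coact m)
  counit : ∀ m : M,
    BTensor.rid (BTensor.map LinearMap.id (Coring.counit (A := A) (C := C)).left (coact m)) = m

section Comodules

variable (A C : Type*) [Ring A] [AddCommGroup C] [Module A C] [Module Aᵐᵒᵖ C]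
    [SMulCommClass A Aᵐᵒᵖ C] [Coring A C]

/-- A left `T`-module structure on the right `C`-comodule `M` making it a `T`-`C`-bicomodule
(`T` being the trivial `T`-coring): a `T`-`A`-bimodule with left `T`-linear coaction. -/
class LeftLinear (T M : Type*) [Ring T] [AddCommGroup M] [Module T M] [Module Aᵐᵒᵖ M]
    [SMulCommClass T Aᵐᵒᵖ M] [Comodule A C M] : Prop where
  coact_smul : ∀ (t : T) (m : M),
    Comodule.coact (A := A) (C := C) (t • m) = t • Comodule.coact (A := A) (C := C) m

/-- `C` is a right comodule over itself. -/
instance Coring.selfComodule : Comodule A C C where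
  coact := (Coring.comul (A := A) (C := C)).right
  coassoc := Coring.coassoc
  counit := Coring.counit_right

instance Coring.selfLeftLinear : LeftLinear A C A C where
  coact_smul t m := (Coring.comul (A := A) (C := C)).left.map_smul t m

variable (M N : Type*) [AddCommGroup M] [Module Aᵐᵒᵖ M] [Comodule A C M]
  [AddCommGroup N] [Module Aᵐᵒᵖ N] [Comodule A C N]

/-- The group of comodule morphisms, as a subgroup of the group of right `A`-linear maps. -/
def comodHom : AddSubgroup (M →ₗ[Aᵐᵒᵖ] N) where
  carrier := {f | ∀ m, BTensor.map f LinearMap.id (Comodule.coact (A := A) (C := C) m) =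
    Comodule.coact (A := A) (C := C) (f m)}
  add_mem' {f g} hf hg m := by
    rw [BTensor.map_add_left, hf m, hg m, LinearMap.add_apply, map_add]
  zero_mem' m := by
    have h := BTensor.map_add_left (0 : M →ₗ[Aᵐᵒᵖ] N) 0 (LinearMap.id : C →ₗ[A] C)
      (Comodule.coact (A := A) (C := C) m)
    simpa using h
  neg_mem' {f} hf m := by
    have h := BTensor.map_add_left f (-f) (LinearMap.id : C →ₗ[A] C)
      (Comodule.coact (A := A) (C := C) m)
    have h0 := BTensor.map_add_left (0 : M →ₗ[Aᵐᵒᵖ] N) 0 (LinearMap.id : C →ₗ[A] C)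
      (Comodule.coact (A := A) (C := C) m)
    simp only [add_zero, left_eq_add] at h0
    rw [add_neg_cancel, h0, hf m] at h
    rw [LinearMap.neg_apply, map_neg]
    exact (neg_eq_of_add_eq_zero_right h.symm).symm

/-- Morphisms of right `C`-comodules. -/
def ComodHom : Type _ := comodHom A C M N

instance : AddCommGroup (ComodHom A C M N) := inferInstanceAs (AddCommGroup (comodHom A C M N))

variable {A C M N}

/-- The underlying right `A`-linear map. -/
def ComodHom.lin (f : ComodHom A C M N) : M →ₗ[Aᵐᵒᵖ] N := f.1

theorem ComodHom.comm (f : ComodHom A C M N) (m : M) :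
    BTensor.map f.lin LinearMap.id (Comodule.coact (A := A) (C := C) m) =
      Comodule.coact (A := A) (C := C) (f.lin m) := f.2 m

theorem ComodHom.ext {f g : ComodHom A C M N} (h : ∀ m, f.lin m = g.lin m) : f = g :=
  Subtype.ext (LinearMap.ext h)

theorem ComodHom.add_lin (f g : ComodHom A C M N) : (f + g).lin = f.lin + g.lin := rfl

variable (A C) in
/-- The identity morphism. -/
def ComodHom.id (M : Type*) [AddCommGroup M] [Module Aᵐᵒᵖ M] [Comodule A C M] :
    ComodHom A C M M :=
  ⟨LinearMap.id, fun _ => BTensor.map_id_id _⟩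

/-- The composite `g ∘ f`. -/
def ComodHom.comp {P : Type*} [AddCommGroup P] [Module Aᵐᵒᵖ P] [Comodule A C P]
    (g : ComodHom A C N P) (f : ComodHom A C M N) : ComodHom A C M P :=
  ⟨g.lin.comp f.lin, fun m => by
    have h := BTensor.map_map f.lin LinearMap.id g.lin LinearMap.id
      (Comodule.coact (A := A) (C := C) m)
    rw [f.comm, g.comm] at h
    exact h.symm⟩

@[simp] theorem ComodHom.comp_lin {P : Type*} [AddCommGroup P] [Module Aᵐᵒᵖ P] [Comodule A C P]
    (g : ComodHom A C N P) (f : ComodHom A C M N) (m : M) :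
    (g.comp f).lin m = g.lin (f.lin m) := rfl

@[simp] theorem ComodHom.id_lin (m : M) : (ComodHom.id A C M).lin m = m := rfl

section HomAction

variable {T : Type*} [Ring T] [Module T M] [SMulCommClass T Aᵐᵒᵖ M] [LeftLinear A C T M]

variable (A C M) in
/-- Left multiplication by `t` as a comodule endomorphism. -/
def ComodHom.lmul (t : T) : ComodHom A C M M :=
  ⟨BTensor.lmul M t, fun m => (LeftLinear.coact_smul (A := A) (C := C) t m).symm⟩

/-- The right `T`-module structure `(f * t) m = f (t * m)` on `Hom(M, N)`. -/
instance ComodHom.rightModule : Module Tᵐᵒᵖ (ComodHom A C M N) where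
  smul t f := f.comp (ComodHom.lmul A C M t.unop)
  one_smul f := ComodHom.ext fun m => by
    change f.lin ((1 : T) • m) = _
    rw [one_smul]
  mul_smul s t f := ComodHom.ext fun m => by
    change f.lin ((t.unop * s.unop) • m) = f.lin (t.unop • s.unop • m)
    rw [mul_smul]
  smul_zero _ := ComodHom.ext fun _ => rfl
  smul_add _ _ _ := ComodHom.ext fun _ => rfl
  add_smul s t f := ComodHom.ext fun m => by
    change f.lin ((s.unop + t.unop) • m) = f.lin (s.unop • m) + f.lin (t.unop • m)
    rw [add_smul, map_add]
  zero_smul f := ComodHom.ext fun m => by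
    change f.lin ((0 : T) • m) = 0
    rw [zero_smul, map_zero]

end HomAction

section TensorComodule

variable (A C) in
/-- The coaction `x ⊗ m ↦ x ⊗ ρ(m)` on `X ⊗ M`, read in `(X ⊗ M) ⊗ C`, for a right `T`-module `X`
and a `T`-`C`-bicomodule `M`. -/
def tensorCoact (T X M : Type*) [Ring T] [AddCommGroup X] [Module Tᵐᵒᵖ X] [AddCommGroup M]
    [Module T M] [Module Aᵐᵒᵖ M] [SMulCommClass T Aᵐᵒᵖ M] [Comodule A C M] [LeftLinear A C T M] :
    BTensor T X M →+ BTensor A (BTensor T X M) C :=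
  BTensor.lift
    (AddMonoidHom.mk'
      (fun x => (BTensor.map (BTensor.tmulHom (T := A) x) LinearMap.id).comp
        (Comodule.coact (A := A) (C := C) (M := M)).toAddMonoidHom)
      (fun a b => by
        ext m
        have h : BTensor.tmulHom (R := T) (N := M) (T := A) (a + b) =
            BTensor.tmulHom a + BTensor.tmulHom b := by
          ext m; simp [BTensor.add_tmul]
        simp [h, BTensor.map_add_left]))
    (fun x t m => by
      have h : BTensor.tmulHom (R := T) (N := M) (T := A) (op t • x) =
          (BTensor.tmulHom x).comp (BTensor.lmul M t) := by
        ext m; simp [BTensor.smul_tmul]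
      simp [h, LeftLinear.coact_smul, BTensor.smul_def, BTensor.map_map])

variable {T X Y : Type*} [Ring T] [AddCommGroup X] [Module Tᵐᵒᵖ X] [AddCommGroup Y] [Module Tᵐᵒᵖ Y]
  [Module T M] [SMulCommClass T Aᵐᵒᵖ M] [LeftLinear A C T M]

@[simp] theorem tensorCoact_tmul (x : X) (m : M) :
    tensorCoact A C T X M (BTensor.tmul T x m) =
      BTensor.map (BTensor.tmulHom (T := A) x) LinearMap.id
        (Comodule.coact (A := A) (C := C) m) := by
  simp [tensorCoact]

/-- `tensorCoact` as a right `A`-linear map. -/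
def tensorCoactLin (A C T X M : Type*) [Ring A] [AddCommGroup C] [Module A C] [Module Aᵐᵒᵖ C]
    [SMulCommClass A Aᵐᵒᵖ C] [Coring A C] [Ring T] [AddCommGroup X] [Module Tᵐᵒᵖ X]
    [AddCommGroup M] [Module T M] [Module Aᵐᵒᵖ M] [SMulCommClass T Aᵐᵒᵖ M] [Comodule A C M]
    [LeftLinear A C T M] :
    BTensor T X M →ₗ[Aᵐᵒᵖ] BTensor A (BTensor T X M) C where
  toFun := tensorCoact A C T X M
  map_add' := map_add _
  map_smul' a z := by
    induction z using BTensor.induction_on with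
    | h0 => simp
    | ht x m => simp [BTensor.map_op_smul]
    | ha x y hx hy => simp only [smul_add, map_add, hx, hy]

/-- `X ⊗ M` is a right `C`-comodule. -/
instance BTensor.comodule : Comodule A C (BTensor T X M) where
  coact := tensorCoactLin A C T X M
  coassoc z := by
    change BTensor.assoc (BTensor.map (tensorCoactLin A C T X M) LinearMap.id
      (tensorCoact A C T X M z)) = BTensor.map LinearMap.id _ (tensorCoact A C T X M z)
    induction z using BTensor.induction_on with
    | h0 => simp
    | ht x m =>
      have h : (tensorCoactLin A C T X M).comp (BTensor.tmulHom x) =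
          (BTensor.mapRight (BTensor.tmulHom x)).comp (Comodule.coact (A := A) (C := C)) :=
        LinearMap.ext fun u => tensorCoact_tmul x u
      have h2 := Comodule.coassoc (A := A) (C := C) m
      rw [tensorCoact_tmul, BTensor.map_map, h]
      have h3 := BTensor.map_map (Comodule.coact (A := A) (C := C) (M := M))
        (LinearMap.id : C →ₗ[A] C)
        (BTensor.mapRight (T := A) (N := C) (BTensor.tmulHom (R := T) (N := M) (T := A) x))
        (LinearMap.id : C →ₗ[A] C) (Comodule.coact (A := A) (C := C) m)
      rw [← h3, BTensor.assoc_map, h2, BTensor.map_map, BTensor.map_map]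
      rfl
    | ha x y hx hy => simp only [map_add, hx, hy]
  counit z := by
    change BTensor.rid (BTensor.map LinearMap.id _ (tensorCoact A C T X M z)) = z
    induction z using BTensor.induction_on with
    | h0 => simp
    | ht x m =>
      have h := Comodule.counit (A := A) (C := C) m
      rw [tensorCoact_tmul, BTensor.map_map]
      have h3 := BTensor.map_map (LinearMap.id : M →ₗ[Aᵐᵒᵖ] M)
        (Coring.counit (A := A) (C := C)).left
        (BTensor.tmulHom (R := T) (N := M) (T := A) x) (LinearMap.id : A →ₗ[A] A)
        (Comodule.coact (A := A) (C := C) m)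
      have h4 := BTensor.rid_map (BTensor.tmulHom (R := T) (N := M) (T := A) x)
        (BTensor.map LinearMap.id (Coring.counit (A := A) (C := C)).left
          (Comodule.coact (A := A) (C := C) m))
      rw [h, h3] at h4
      exact h4
    | ha x y hx hy => simp only [map_add, hx, hy]

variable (A C M) in
/-- The comodule morphism `f ⊗ M`. -/
def ComodHom.tensor (f : X →ₗ[Tᵐᵒᵖ] Y) : ComodHom A C (BTensor T X M) (BTensor T Y M) :=
  ⟨BTensor.mapRight f, fun z => by
    change BTensor.map (BTensor.mapRight f) LinearMap.id (tensorCoact A C T X M z) =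
      tensorCoact A C T Y M (BTensor.map f LinearMap.id z)
    induction z using BTensor.induction_on with
    | h0 => simp
    | ht x m =>
      rw [tensorCoact_tmul, BTensor.map_map, BTensor.map_tmul, LinearMap.id_apply,
        tensorCoact_tmul]
      congr 2
    | ha x y hx hy => simp only [map_add, hx, hy]⟩

end TensorComodule

end Comodules

/-- `C` is coseparable: `Δ` is a section in the category of `C`-bicomodules, that is, there is an
`A`-bimodule map `π : C ⊗ C → C`, right and left `C`-colinear, with `π ∘ Δ = id`. Here `C ⊗ C` has
the right coaction `C ⊗ Δ` and the left coaction `Δ ⊗ C`. -/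
def IsCoseparable (A C : Type*) [Ring A] [AddCommGroup C] [Module A C] [Module Aᵐᵒᵖ C]
    [SMulCommClass A Aᵐᵒᵖ C] [Coring A C] : Prop :=
  ∃ π : BimodHom A A (BTensor A C C) C,
    π.right ∈ comodHom A C (BTensor A C C) C ∧
    (∀ z : BTensor A C C, BTensor.map LinearMap.id π.left
        (BTensor.assoc (BTensor.map (Coring.comul (A := A) (C := C)).right LinearMap.id z)) =
      (Coring.comul (A := A) (C := C)).left (π.left z)) ∧
    ∀ c : C, π.left ((Coring.comul (A := A) (C := C)).left c) = c

section Category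

variable (A C : Type u) [Ring A] [AddCommGroup C] [Module A C] [Module Aᵐᵒᵖ C]
    [SMulCommClass A Aᵐᵒᵖ C] [Coring A C]

/-- The category of right `C`-comodules. -/
structure RComod where
  /-- the underlying type -/
  carrier : Type u
  [addCommGroup : AddCommGroup carrier]
  [module : Module Aᵐᵒᵖ carrier]
  [comodule : Comodule A C carrier]

attribute [instance] RComod.addCommGroup RComod.module RComod.comodule

/-- Bundling a comodule. -/
abbrev RComod.of (M : Type u) [AddCommGroup M] [Module Aᵐᵒᵖ M] [Comodule A C M] : RComod A C :=
  { carrier := M }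

instance : Category.{u} (RComod A C) where
  Hom M N := ComodHom A C M.carrier N.carrier
  id M := ComodHom.id A C M.carrier
  comp f g := ComodHom.comp g f

instance : Preadditive (RComod A C) where
  homGroup M N := inferInstanceAs (AddCommGroup (ComodHom A C M.carrier N.carrier))
  add_comp _ _ _ f g h := ComodHom.ext fun m => map_add h.lin (f.lin m) (g.lin m)
  comp_add _ _ _ _ _ _ := ComodHom.ext fun _ => rfl

variable (B S : Type u) [Ring B] [AddCommGroup S] [Module B S] [Module Aᵐᵒᵖ S]
  [SMulCommClass B Aᵐᵒᵖ S] [Comodule A C S] [LeftLinear A C B S]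

/-- The functor `F = - ⊗ S` from right `B`-modules to right `C`-comodules. -/
def tensorFunctor : ModuleCat.{u} Bᵐᵒᵖ ⥤ RComod A C where
  obj X := RComod.of A C (BTensor B X S)
  map f := ComodHom.tensor A C S f.hom
  map_id _ := ComodHom.ext fun z => BTensor.map_id_id z
  map_comp f g := ComodHom.ext fun z =>
    (BTensor.map_map f.hom LinearMap.id g.hom LinearMap.id z).symm

/-- The functor `G = Hom(S, -)` from right `C`-comodules to right `B`-modules. -/
def homFunctor : RComod A C ⥤ ModuleCat.{u} Bᵐᵒᵖ where
  obj M := ModuleCat.of Bᵐᵒᵖ (ComodHom A C S M.carrier)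
  map {M N} f := ModuleCat.ofHom
    { toFun := fun g => ComodHom.comp (N := M.carrier) f g
      map_add' := fun g h => ComodHom.ext fun m =>
        map_add (ComodHom.lin (M := M.carrier) (N := N.carrier) f) (g.lin m) (h.lin m)
      map_smul' := fun _ _ => rfl }
  map_id _ := rfl
  map_comp _ _ := rfl

/-- The ring homomorphism `φ : B → End(S)`, `φ(b)(u) = b * u`. -/
def actionHom : B →+* End (RComod.of A C S) where
  toFun b := ComodHom.lmul A C S b
  map_one' := ComodHom.ext (M := S) (N := S) fun m => one_smul B m
  map_mul' a b := ComodHom.ext (M := S) (N := S) fun m => mul_smul a b m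
  map_zero' := ComodHom.ext (M := S) (N := S) fun m => zero_smul B m
  map_add' a b := ComodHom.ext (M := S) (N := S) fun m => add_smul a b m

end Category

section Can

/-- The dual `S* = Hom(S, A)` of a right `A`-module. -/
def RDual (A S : Type*) [Ring A] [AddCommGroup S] [Module Aᵐᵒᵖ S] : Type _ := S →ₗ[Aᵐᵒᵖ] A

instance (A S : Type*) [Ring A] [AddCommGroup S] [Module Aᵐᵒᵖ S] : AddCommGroup (RDual A S) :=
  inferInstanceAs (AddCommGroup (S →ₗ[Aᵐᵒᵖ] A))

variable {A S : Type*} [Ring A] [AddCommGroup S] [Module Aᵐᵒᵖ S]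

/-- An element of the dual as a linear map. -/
def RDual.lin (f : RDual A S) : S →ₗ[Aᵐᵒᵖ] A := f

theorem RDual.ext {f g : RDual A S} (h : ∀ s, f.lin s = g.lin s) : f = g := LinearMap.ext h

/-- The right `B`-module structure `(f * b)(u) = f(b * u)` on the dual of a `B`-`A`-bimodule. -/
instance RDual.rightModule {B : Type*} [Ring B] [Module B S] [SMulCommClass B Aᵐᵒᵖ S] :
    Module Bᵐᵒᵖ (RDual A S) where
  smul b f := (f.lin.comp (BTensor.lmul S b.unop) : S →ₗ[Aᵐᵒᵖ] A)
  one_smul f := RDual.ext fun m => by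
    change f.lin ((1 : B) • m) = _
    rw [one_smul]
  mul_smul s t f := RDual.ext fun m => by
    change f.lin ((t.unop * s.unop) • m) = f.lin (t.unop • s.unop • m)
    rw [mul_smul]
  smul_zero _ := RDual.ext fun _ => rfl
  smul_add _ _ _ := RDual.ext fun _ => rfl
  add_smul s t f := RDual.ext fun m => by
    change f.lin ((s.unop + t.unop) • m) = f.lin (s.unop • m) + f.lin (t.unop • m)
    rw [add_smul, map_add]
  zero_smul f := RDual.ext fun m => by
    change f.lin ((0 : B) • m) = 0
    rw [zero_smul, map_zero]

/-- The canonical map `can : S* ⊗ S → C`, `f ⊗ u ↦ f(u₀) * u₁`, where `ρ(u) = u₀ ⊗ u₁`. -/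
def canMap (A C B S : Type*) [Ring A] [AddCommGroup C] [Module A C] [Module Aᵐᵒᵖ C]
    [SMulCommClass A Aᵐᵒᵖ C] [Coring A C] [Ring B] [AddCommGroup S] [Module B S] [Module Aᵐᵒᵖ S]
    [SMulCommClass B Aᵐᵒᵖ S] [Comodule A C S] [LeftLinear A C B S] :
    BTensor B (RDual A S) S →+ C :=
  BTensor.lift
    (AddMonoidHom.mk'
      (fun f => (BTensor.lid.comp (BTensor.map f.lin LinearMap.id)).comp
        (Comodule.coact (A := A) (C := C) (M := S)).toAddMonoidHom)
      (fun f g => by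
        ext u
        have h : RDual.lin (f + g) = f.lin + g.lin := rfl
        simp [h, BTensor.map_add_left]))
    (fun f b u => by
      have h : RDual.lin (op b • f) = f.lin.comp (BTensor.lmul S b) := rfl
      simp [h, LeftLinear.coact_smul, BTensor.smul_def, BTensor.map_map])

end Can

/-- The left `R`-module `N` is flat: `- ⊗ N` preserves injective maps of right `R`-modules. -/
def LeftFlat (R N : Type u) [Ring R] [AddCommGroup N] [Module R N] : Prop :=
  ∀ (X Y : Type u) [AddCommGroup X] [Module Rᵐᵒᵖ X] [AddCommGroup Y] [Module Rᵐᵒᵖ Y]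
    (f : X →ₗ[Rᵐᵒᵖ] Y), Function.Injective f →
      Function.Injective (BTensor.map f (LinearMap.id : N →ₗ[R] N))

/-- The left `R`-module `N` is faithfully flat: it is flat, and `X ⊗ N = 0` only for `X = 0`. -/
def LeftFaithfullyFlat (R N : Type u) [Ring R] [AddCommGroup N] [Module R N] : Prop :=
  LeftFlat R N ∧ ∀ (X : Type u) [AddCommGroup X] [Module Rᵐᵒᵖ X],
    Subsingleton (BTensor R X N) → Subsingleton X

/-- The left `R`-module `N` is completely faithful: for every right `R`-module `X`, the annihilator
`{x | x ⊗ n = 0 for all n}` of `N` in `X` is zero. -/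
def LeftCompletelyFaithful (R N : Type u) [Ring R] [AddCommGroup N] [Module R N] : Prop :=
  ∀ (X : Type u) [AddCommGroup X] [Module Rᵐᵒᵖ X] (x : X),
    (∀ n : N, BTensor.tmul R x n = 0) → x = 0

/-- `U` is a generator: for every proper subobject `X → Y` there is a morphism `U → Y` that does
not factor through `X`. -/
def IsGenerator {𝒞 : Type*} [Category 𝒞] (U : 𝒞) : Prop :=
  ∀ ⦃X Y : 𝒞⦄ (i : X ⟶ Y) [Mono i], ¬ IsIso i → ∃ v : U ⟶ Y, ¬ ∃ w : U ⟶ X, w ≫ i = v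

/-- `F` and `G` are inverse equivalences of categories. -/
def AreInverseEquivalences {𝒞 𝒟 : Type*} [Category 𝒞] [Category 𝒟] (F : 𝒞 ⥤ 𝒟) (G : 𝒟 ⥤ 𝒞) :
    Prop :=
  Nonempty (F ⋙ G ≅ 𝟭 𝒞) ∧ Nonempty (G ⋙ F ≅ 𝟭 𝒟)

/-! The functor `- ⊗_B S` is left adjoint to `Hom_C(S, -)`, with unit `η_X : x ↦ (u ↦ x ⊗ u)` and
counit `ε_M` given by evaluation. The functors are inverse equivalences exactly when every `η_X` and
every `ε_M` is bijective (`areInverseEquivalences_iff`), so everything turns on these two maps. At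
special objects they are the given data: `η_B` is `φ` through `B ⊗ S ≅ S`, and `ε_C` is `can`
through `S* ≅ Hom_C(S, C)`.

Counit. As `S` is finitely generated projective over `A`, bijectivity of `can` makes `canAt :
Hom_A(S, M) ⊗_B S → M ⊗_A C` bijective for every `M` (`canAt_bijective`). Now `Hom_C(S, M)` is the
kernel of a map `Hom_A(S, M) → Hom_A(S, M ⊗ C)`. If `S` is flat over `B`, tensoring with `S` keeps
this kernel, and `canAt` matches it with the image of the coaction of `M`; hence `ε_M` is bijective
(`evalHom_bijective_of_flat`). The same comparison shows that `C` is flat. For flat `C`, kernels and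
images are comodules, so `S` is a generator exactly when all `ε_M` are surjective. Surjective
counits together with surjective units are then injective (`evalHom_injective_of_surjective`).

Unit. If `S` is a projective comodule and `φ` is bijective, `η` is bijective at free modules and
then everywhere by free presentations (`unitHom_bijective_of_projective`). If instead `S` is
faithfully flat, bijectivity of `η_X` is detected after tensoring with `S`, where `η_X ⊗ S` is
inverse to `ε_{X ⊗ S}`.

Coseparable case. With `δ` the counit of `C` composed with the splitting `π`, the map `m ⊗ c ↦ m₀
δ(m₁ ⊗ c)` is a natural colinear retraction of every coaction (`IsCoseparator.retraction`). It
yields an averaging projection of `Hom_A(S, M)` onto `Hom_C(S, M)`, which replaces both flatness of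
`S` and projectivity of the comodule `S` (`IsCoseparator.evalHom_bijective`,
`IsCoseparator.unitHom_bijective`). -/

namespace BTensor

/-! ### Exactness and coordinates for balanced tensor products. -/

section General

variable {R : Type*} [Ring R] {M M' M'' N N' : Type*}
  [AddCommGroup M] [Module Rᵐᵒᵖ M] [AddCommGroup M'] [Module Rᵐᵒᵖ M']
  [AddCommGroup M''] [Module Rᵐᵒᵖ M'']
  [AddCommGroup N] [Module R N] [AddCommGroup N'] [Module R N']

/-- The biadditive map `m ↦ n ↦ m ⊗ n`. -/
def mk : M →+ N →+ BTensor R M N :=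
  AddMonoidHom.mk' (fun m => AddMonoidHom.mk' (fun n => tmul R m n) (tmul_add R m))
    (fun a b => by ext n; simp [add_tmul])

@[simp] theorem mk_apply (m : M) (n : N) : mk m n = tmul R m n := rfl

@[simp] theorem zero_tmul (n : N) : tmul R (0 : M) n = 0 :=
  DFunLike.congr_fun (map_zero (mk (R := R) (M := M) (N := N))) n

@[simp] theorem tmul_zero (m : M) : tmul R m (0 : N) = 0 :=
  map_zero (mk (R := R) (M := M) (N := N) m)

theorem sum_tmul {ι : Type*} (t : Finset ι) (f : ι → M) (n : N) :
    tmul R (∑ i ∈ t, f i) n = ∑ i ∈ t, tmul R (f i) n := by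
  rw [← mk_apply, map_sum, AddMonoidHom.finsetSum_apply]
  rfl

theorem tmul_sum {ι : Type*} (t : Finset ι) (m : M) (f : ι → N) :
    tmul R m (∑ i ∈ t, f i) = ∑ i ∈ t, tmul R m (f i) :=
  map_sum (mk (R := R) m) f t

theorem map_zero_left (g : N →ₗ[R] N') (z : BTensor R M N) :
    map (0 : M →ₗ[Rᵐᵒᵖ] M') g z = 0 := by
  induction z using induction_on with
  | h0 => simp
  | ht m n => simp
  | ha x y hx hy => rw [map_add, hx, hy, add_zero]

theorem map_sub_left (f f' : M →ₗ[Rᵐᵒᵖ] M') (g : N →ₗ[R] N') (z : BTensor R M N) :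
    map (f - f') g z = map f g z - map f' g z := by
  rw [eq_sub_iff_add_eq, ← map_add_left, sub_add_cancel]

theorem map_surjective {f : M →ₗ[Rᵐᵒᵖ] M'} {g : N →ₗ[R] N'} (hf : Function.Surjective f)
    (hg : Function.Surjective g) : Function.Surjective (map f g) := by
  intro z
  induction z using induction_on with
  | h0 => exact ⟨0, map_zero _⟩
  | ht m n =>
    obtain ⟨m, rfl⟩ := hf m
    obtain ⟨n, rfl⟩ := hg n
    exact ⟨tmul R m n, map_tmul f g m n⟩
  | ha x y hx hy =>
    obtain ⟨x, rfl⟩ := hx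
    obtain ⟨y, rfl⟩ := hy
    exact ⟨x + y, map_add _ _ _⟩

theorem map_injective_of_leftInverse {f : M →ₗ[Rᵐᵒᵖ] M'} (h : M' →ₗ[Rᵐᵒᵖ] M)
    (hf : ∀ m, h (f m) = m) :
    Function.Injective (map f (LinearMap.id : N →ₗ[R] N)) := by
  refine Function.LeftInverse.injective (g := map h (LinearMap.id : N →ₗ[R] N)) fun z => ?_
  rw [map_map, show h.comp f = LinearMap.id from LinearMap.ext hf]
  exact map_id_id z

theorem map_bijective_of_bijective {f : M →ₗ[Rᵐᵒᵖ] M'} (hf : Function.Bijective f) :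
    Function.Bijective (map f (LinearMap.id : N →ₗ[R] N)) :=
  ⟨map_injective_of_leftInverse (LinearEquiv.ofBijective f hf).symm.toLinearMap
      (LinearEquiv.ofBijective f hf).symm_apply_apply,
    map_surjective hf.2 Function.surjective_id⟩

/-- Right exactness of the tensor product. -/
theorem exists_of_map_mkQ_eq_zero (K : Submodule Rᵐᵒᵖ M) (z : BTensor R M N)
    (hz : map K.mkQ (LinearMap.id : N →ₗ[R] N) z = 0) :
    ∃ w : BTensor R K N, map K.subtype LinearMap.id w = z := by
  let I : AddSubgroup (BTensor R M N) := (map K.subtype (LinearMap.id : N →ₗ[R] N)).range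
  have hI : ∀ k ∈ K, ∀ n : N, tmul R k n ∈ I := fun k hk n => ⟨tmul R ⟨k, hk⟩ n, by simp⟩
  let f : M ⧸ K →+ N →+ BTensor R M N ⧸ I :=
    QuotientAddGroup.lift K.toAddSubgroup
      (((AddMonoidHom.compHom (QuotientAddGroup.mk' I))).comp (mk (R := R) (M := M) (N := N)))
      (fun k hk => by
        ext n
        exact (QuotientAddGroup.eq_zero_iff _).2 (hI k hk n))
  have hf : ∀ (m : M) (n : N), f (K.mkQ m) n = QuotientAddGroup.mk' I (tmul R m n) :=
    fun m n => rfl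
  -- Composing `F` with `mkQ ⊗ N` gives the projection modulo the image `I` of `K ⊗ N`, so the
  -- kernel of `mkQ ⊗ N` lies in `I`.
  let F : BTensor R (M ⧸ K) N →+ BTensor R M N ⧸ I := lift f (fun q r n => by
    obtain ⟨m, rfl⟩ := K.mkQ_surjective q
    rw [← map_smul, hf, hf, smul_tmul])
  have hF : F.comp (map K.mkQ (LinearMap.id : N →ₗ[R] N)) = QuotientAddGroup.mk' I :=
    hom_ext fun m n => by
      rw [AddMonoidHom.comp_apply, map_tmul]
      exact hf m n
  have h := DFunLike.congr_fun hF z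
  rw [AddMonoidHom.comp_apply, hz, map_zero] at h
  exact (QuotientAddGroup.eq_zero_iff _).1 h.symm

/-- The exactness of `K ⊗ N → M ⊗ N → M' ⊗ N` for an exact sequence `K → M → M' → 0`. -/
theorem exists_of_map_eq_zero_of_surjective {f : M →ₗ[Rᵐᵒᵖ] M'} (hf : Function.Surjective f)
    (z : BTensor R M N) (hz : map f (LinearMap.id : N →ₗ[R] N) z = 0) :
    ∃ w : BTensor R (LinearMap.ker f) N, map (LinearMap.ker f).subtype LinearMap.id w = z := by
  refine exists_of_map_mkQ_eq_zero _ z ?_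
  refine (map_bijective_of_bijective (N := N) (f := (f.quotKerEquivOfSurjective hf).toLinearMap)
    (LinearEquiv.bijective _)).1 ?_
  rw [map_map, map_zero]
  exact hz

/-- Allowing every finite set above `t` lets the induction put two summands over a common index set.
-/
theorem eq_sum_of_leftCoordinates {ι : Type*} (z : BTensor R (ι →₀ R) N) :
    ∃ t : Finset ι, ∀ t', t ⊆ t' → z = ∑ i ∈ t', tmul R (Finsupp.single i (1 : R))
      (lid (map (Finsupp.lapply i : (ι →₀ R) →ₗ[Rᵐᵒᵖ] R) (LinearMap.id : N →ₗ[R] N) z)) := by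
  classical
  induction z using induction_on with
  | h0 => exact ⟨∅, fun t' _ => by simp⟩
  | ht m n =>
    refine ⟨m.support, fun t' ht => ?_⟩
    have hm : m = ∑ i ∈ t', op (m i) • Finsupp.single i (1 : R) := by
      conv_lhs => rw [← Finsupp.sum_single m]
      rw [Finsupp.sum_of_support_subset _ ht _ (by simp)]
      simp
    conv_lhs => rw [hm]
    simp only [sum_tmul, smul_tmul, map_tmul, lid_tmul, Finsupp.lapply_apply, LinearMap.id_apply]
  | ha x y hx hy =>
    obtain ⟨s, hs⟩ := hx
    obtain ⟨t, ht⟩ := hy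
    refine ⟨s ∪ t, fun t' h => ?_⟩
    conv_lhs => rw [hs t' (Finset.union_subset_left h), ht t' (Finset.union_subset_right h)]
    simp [tmul_add, Finset.sum_add_distrib]

theorem ext_leftCoordinates {ι : Type*} {z w : BTensor R (ι →₀ R) N}
    (h : ∀ i, lid (map (Finsupp.lapply i : (ι →₀ R) →ₗ[Rᵐᵒᵖ] R) (LinearMap.id : N →ₗ[R] N) z) =
      lid (map (Finsupp.lapply i : (ι →₀ R) →ₗ[Rᵐᵒᵖ] R) (LinearMap.id : N →ₗ[R] N) w)) :
    z = w := by
  classical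
  obtain ⟨s, hs⟩ := eq_sum_of_leftCoordinates z
  obtain ⟨t, ht⟩ := eq_sum_of_leftCoordinates w
  rw [hs (s ∪ t) Finset.subset_union_left, ht (s ∪ t) Finset.subset_union_right]
  simp only [h]

theorem exists_finset_coordinates_eq_zero {ι : Type*} (z : BTensor R (ι →₀ R) N) :
    ∃ t : Finset ι, ∀ i ∉ t,
      lid (map (Finsupp.lapply i : (ι →₀ R) →ₗ[Rᵐᵒᵖ] R) (LinearMap.id : N →ₗ[R] N) z) = 0 := by
  classical
  induction z using induction_on with
  | h0 => exact ⟨∅, fun t' _ => by simp⟩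
  | ht m n => exact ⟨m.support, fun i hi => by simp [Finsupp.notMem_support_iff.1 hi]⟩
  | ha x y hx hy =>
    obtain ⟨s, hs⟩ := hx
    obtain ⟨t, ht⟩ := hy
    refine ⟨s ∪ t, fun i hi => ?_⟩
    rw [Finset.mem_union, not_or] at hi
    rw [map_add, map_add, hs i hi.1, ht i hi.2, add_zero]

/-- A projective left module is flat. -/
theorem map_injective_of_projective [Module.Projective R N] {f : M →ₗ[Rᵐᵒᵖ] M'}
    (hf : Function.Injective f) : Function.Injective (map f (LinearMap.id : N →ₗ[R] N)) := by
  classical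
  obtain ⟨s, hs⟩ := Module.projective_def'.1 ‹Module.Projective R N›
  let χ (i : N) : N →ₗ[R] R := (Finsupp.lapply i).comp s
  -- A section `s` of the free cover on the set `N` provides a dual basis `(i, χ i)` indexed by `N`
  -- itself, and `z` is recovered from its coordinates in `M`. These commute with `f`, so they
  -- vanish as soon as `f ⊗ N` kills `z`.
  have key : ∀ z : BTensor R M N, ∃ t : Finset N, ∀ t', t ⊆ t' →
      z = ∑ i ∈ t', tmul R (rid (map (LinearMap.id : M →ₗ[Rᵐᵒᵖ] M) (χ i) z)) i := by
    intro z
    induction z using induction_on with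
    | h0 => exact ⟨∅, fun t' _ => by simp⟩
    | ht m n =>
      refine ⟨(s n).support, fun t' ht => ?_⟩
      have hn : n = ∑ i ∈ t', s n i • i := by
        conv_lhs => rw [← show Finsupp.linearCombination R id (s n) = n from
          DFunLike.congr_fun hs n]
        rw [Finsupp.linearCombination_apply, Finsupp.sum_of_support_subset _ ht _ (by simp)]
        simp
      conv_lhs => rw [hn]
      simp [χ, tmul_sum, smul_tmul]
    | ha x y hx hy =>
      obtain ⟨s, hs⟩ := hx
      obtain ⟨t, ht⟩ := hy
      refine ⟨s ∪ t, fun t' h => ?_⟩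
      conv_lhs => rw [hs t' (Finset.union_subset_left h), ht t' (Finset.union_subset_right h)]
      simp [add_tmul, Finset.sum_add_distrib]
  refine (injective_iff_map_eq_zero _).2 fun z hz => ?_
  obtain ⟨t, ht⟩ := key z
  rw [ht t subset_rfl]
  refine Finset.sum_eq_zero fun i _ => ?_
  have h : f (rid (map (LinearMap.id : M →ₗ[Rᵐᵒᵖ] M) (χ i) z)) = 0 := by
    have h1 := rid_map f (map (LinearMap.id : M →ₗ[Rᵐᵒᵖ] M) (χ i) z)
    rw [← h1, map_map]
    have h2 := map_map f (LinearMap.id : N →ₗ[R] N) (LinearMap.id : M' →ₗ[Rᵐᵒᵖ] M') (χ i) z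
    rw [hz, map_zero] at h2
    rw [LinearMap.comp_id, LinearMap.id_comp] at *
    rw [← h2, map_zero]
  rw [(injective_iff_map_eq_zero f).1 hf _ h, zero_tmul]

theorem lid_bijective : Function.Bijective (lid : BTensor R R N →+ N) := by
  refine Function.bijective_iff_has_inverse.2 ⟨fun n => tmul R 1 n, fun z => ?_, fun n => by simp⟩
  induction z using induction_on with
  | h0 => simp
  | ht r n => simp [← smul_tmul]
  | ha x y hx hy => simp only [map_add, tmul_add, hx, hy]

theorem assoc_bijective {T Q : Type*} [Ring T] [Module Tᵐᵒᵖ N] [SMulCommClass R Tᵐᵒᵖ N]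
    [AddCommGroup Q] [Module T Q] :
    Function.Bijective (assoc (R := R) (M := M) (N := N) (T := T) (Q := Q)) := by
  refine Function.bijective_iff_has_inverse.2 ⟨assocInv, assocInv_assoc, fun z => ?_⟩
  induction z using induction_on with
  | h0 => simp
  | ht m w =>
    induction w using induction_on with
    | h0 => simp
    | ht n q => simp [assocInv]
    | ha x y hx hy => rw [tmul_add, map_add, map_add, hx, hy]
  | ha x y hx hy => rw [map_add, map_add, hx, hy]

end General

end BTensor

/-! ### Flat, faithfully flat and completely faithful modules. -/

section Flat

variable {R N : Type u} [Ring R] [AddCommGroup N] [Module R N]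
  {X Y : Type u} [AddCommGroup X] [Module Rᵐᵒᵖ X] [AddCommGroup Y] [Module Rᵐᵒᵖ Y]

theorem LeftFlat.of_projective [Module.Projective R N] : LeftFlat R N :=
  fun _ _ _ _ _ _ _ hf => BTensor.map_injective_of_projective hf

/-- Factor `f` through the injection of `X / ker f` into `Y`. This injection stays injective after
tensoring, so `z` already dies in `(X / ker f) ⊗ N`, and right exactness applies. -/
theorem LeftFlat.exists_of_map_eq_zero (h : LeftFlat R N) (f : X →ₗ[Rᵐᵒᵖ] Y) (z : BTensor R X N)
    (hz : BTensor.map f (LinearMap.id : N →ₗ[R] N) z = 0) :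
    ∃ w : BTensor R (LinearMap.ker f) N,
      BTensor.map (LinearMap.ker f).subtype LinearMap.id w = z := by
  refine BTensor.exists_of_map_mkQ_eq_zero _ z (h _ _ ((LinearMap.ker f).liftQ f le_rfl)
    (LinearMap.ker_eq_bot.1 (Submodule.ker_liftQ_eq_bot' _ f rfl)) ?_)
  rw [BTensor.map_map, map_zero, Submodule.liftQ_mkQ]
  exact hz

/-- If `N` is completely faithful, `X ⊗ N = 0` only for `X = 0`. -/
theorem LeftCompletelyFaithful.subsingleton (h : LeftCompletelyFaithful R N)
    (hX : Subsingleton (BTensor R X N)) : Subsingleton X :=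
  ⟨fun x y => sub_eq_zero.1 (h X (x - y) fun _ => Subsingleton.elim _ _)⟩

/-- If `N` kills no nonzero module, a map that becomes surjective after tensoring is surjective. -/
theorem surjective_of_map_surjective
    (h : ∀ (X : Type u) [AddCommGroup X] [Module Rᵐᵒᵖ X],
      Subsingleton (BTensor R X N) → Subsingleton X)
    (f : X →ₗ[Rᵐᵒᵖ] Y)
    (hf : Function.Surjective (BTensor.map f (LinearMap.id : N →ₗ[R] N))) :
    Function.Surjective f := by
  rw [← LinearMap.range_eq_top, ← Submodule.Quotient.subsingleton_iff]
  refine h _ ⟨fun a b => ?_⟩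
  -- Each element of `coker f ⊗ N` comes from `Y ⊗ N`, hence from `X ⊗ N`, along a composite that is
  -- zero.
  have hz : ∀ a, a = (0 : BTensor R (Y ⧸ LinearMap.range f) N) := by
    intro a
    obtain ⟨a, rfl⟩ := BTensor.map_surjective (LinearMap.range f).mkQ_surjective
      (g := (LinearMap.id : N →ₗ[R] N)) Function.surjective_id a
    obtain ⟨a, rfl⟩ := hf a
    rw [BTensor.map_map, LinearMap.range_mkQ_comp, BTensor.map_zero_left]
  rw [hz a, hz b]

/-- By flatness `ker f ⊗ N` embeds in `X ⊗ N`, where the injective `f ⊗ N` kills it. So it is zero,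
and then `ker f` is zero. -/
theorem LeftFaithfullyFlat.injective_of_map_injective (h : LeftFaithfullyFlat R N)
    (f : X →ₗ[Rᵐᵒᵖ] Y) (hf : Function.Injective (BTensor.map f (LinearMap.id : N →ₗ[R] N))) :
    Function.Injective f := by
  rw [← LinearMap.ker_eq_bot, ← Submodule.subsingleton_iff_eq_bot]
  refine h.2 _ ⟨fun a b => ?_⟩
  refine h.1 _ _ _ (LinearMap.ker f).injective_subtype (hf ?_)
  rw [BTensor.map_map, BTensor.map_map, LinearMap.comp_ker_subtype, BTensor.map_zero_left,
    BTensor.map_zero_left]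

end Flat

/-! ### Kernels, images and monomorphisms of comodules over a flat coring. -/

section Subcomodules

variable {A C : Type u} [Ring A] [AddCommGroup C] [Module A C] [Module Aᵐᵒᵖ C]
  [SMulCommClass A Aᵐᵒᵖ C] [Coring A C]
  {M N X : Type u} [AddCommGroup M] [Module Aᵐᵒᵖ M] [Comodule A C M]
  [AddCommGroup N] [Module Aᵐᵒᵖ N] [Comodule A C N]
  [AddCommGroup X] [Module Aᵐᵒᵖ X] [Comodule A C X]

/-- Morphisms lift along an injective morphism that contains their image. -/
theorem ComodHom.exists_lift (hC : LeftFlat A C) (ι : ComodHom A C M N)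
    (hι : Function.Injective ι.lin) (g : ComodHom A C X N)
    (hg : LinearMap.range g.lin ≤ LinearMap.range ι.lin) :
    ∃ g' : ComodHom A C X M, ι.comp g' = g := by
  let g' : X →ₗ[Aᵐᵒᵖ] M := (LinearEquiv.ofInjective ι.lin hι).symm.toLinearMap.comp
    (g.lin.codRestrict _ fun x => hg ⟨x, rfl⟩)
  have h : ι.lin.comp g' = g.lin := LinearMap.ext fun x =>
    congrArg Subtype.val ((LinearEquiv.ofInjective ι.lin hι).apply_symm_apply
      (g.lin.codRestrict _ (fun x => hg ⟨x, rfl⟩) x))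
  -- Colinearity of the lift may be tested after the injection `ι ⊗ C`, where it becomes colinearity
  -- of `g`.
  refine ⟨⟨g', fun x => hC _ _ ι.lin hι ?_⟩, ComodHom.ext (LinearMap.congr_fun h)⟩
  rw [BTensor.map_map, ι.comm, h]
  exact (g.comm x).trans (congrArg _ (LinearMap.congr_fun h x).symm)

section

variable (hC : LeftFlat A C) (L : Submodule Aᵐᵒᵖ M)
  (hL : ∀ l ∈ L, ∃ w : BTensor A L C, BTensor.map L.subtype (LinearMap.id : C →ₗ[A] C) w =
    Comodule.coact (A := A) (C := C) l)

/-- The restricted coaction on a stable submodule. -/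
noncomputable def restrictCoact : L →ₗ[Aᵐᵒᵖ] BTensor A L C :=
  (LinearEquiv.ofInjective (BTensor.mapRight (T := A) (N := C) L.subtype)
    (hC _ _ _ L.injective_subtype)).symm.toLinearMap.comp
    (((Comodule.coact (A := A) (C := C) (M := M)).comp L.subtype).codRestrict _
      fun l => hL l l.2)

theorem map_restrictCoact (l : L) :
    BTensor.map L.subtype LinearMap.id (restrictCoact hC L hL l) =
      Comodule.coact (A := A) (C := C) (l : M) :=
  congrArg Subtype.val ((LinearEquiv.ofInjective (BTensor.mapRight (T := A) (N := C) L.subtype)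
    (hC _ _ _ L.injective_subtype)).apply_symm_apply _)

/-- The comodule structure on a stable submodule. -/
@[reducible] noncomputable def Comodule.restrict : Comodule A C L where
  coact := restrictCoact hC L hL
  coassoc l := by
    -- Rewriting the right side as `assoc w` moves the comparison into `(L ⊗ C) ⊗ C`. Flatness, used
    -- twice, embeds this in `(M ⊗ C) ⊗ C`, where coassociativity for `M` decides.
    obtain ⟨w, hw⟩ := BTensor.assoc_bijective.2 (BTensor.map LinearMap.id
      (Coring.comul (A := A) (C := C)).left (restrictCoact hC L hL l))
    rw [← hw]
    congr 1
    refine hC _ _ (BTensor.mapRight (T := A) (N := C) L.subtype)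
      (hC _ _ _ L.injective_subtype) (BTensor.assoc_bijective.1 ?_)
    rw [BTensor.assoc_map, BTensor.assoc_map, hw]
    have h : (BTensor.mapRight (T := A) (N := C) L.subtype).comp (restrictCoact hC L hL) =
        (Comodule.coact (A := A) (C := C)).comp L.subtype :=
      LinearMap.ext (map_restrictCoact hC L hL)
    rw [← BTensor.assoc_map, BTensor.map_map, h]
    have h2 := Comodule.coassoc (A := A) (C := C) (l : M)
    rw [← map_restrictCoact hC L hL l, BTensor.map_map, BTensor.map_map] at h2
    rw [BTensor.map_map]
    exact h2
  counit l := by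
    refine L.injective_subtype ?_
    rw [← BTensor.rid_map, BTensor.map_map]
    have h := Comodule.counit (A := A) (C := C) (l : M)
    rw [← map_restrictCoact hC L hL l, BTensor.map_map] at h
    exact h

/-- The inclusion of a stable submodule. -/
noncomputable def ComodHom.restrictSubtype :
    letI := Comodule.restrict hC L hL
    ComodHom A C L M :=
  letI := Comodule.restrict hC L hL
  ⟨L.subtype, map_restrictCoact hC L hL⟩

end

/-- The coaction of `f m` is `(f ⊗ C)(ρ m)`, which visibly comes from `im f ⊗ C`; no flatness is
needed here. -/
theorem range_stable (f : ComodHom A C M N) : ∀ l ∈ LinearMap.range f.lin,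
    ∃ w : BTensor A (LinearMap.range f.lin) C,
      BTensor.map (LinearMap.range f.lin).subtype (LinearMap.id : C →ₗ[A] C) w =
        Comodule.coact (A := A) (C := C) l := by
  rintro _ ⟨m, rfl⟩
  refine ⟨BTensor.map f.lin.rangeRestrict LinearMap.id (Comodule.coact (A := A) (C := C) m), ?_⟩
  rw [BTensor.map_map]
  exact f.comm m

/-- Colinearity puts `ρ l` in the kernel of `f ⊗ C`, which for flat `C` is the image of `ker f ⊗ C`.
-/
theorem ker_stable (hC : LeftFlat A C) (f : ComodHom A C M N) : ∀ l ∈ LinearMap.ker f.lin,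
    ∃ w : BTensor A (LinearMap.ker f.lin) C,
      BTensor.map (LinearMap.ker f.lin).subtype (LinearMap.id : C →ₗ[A] C) w =
        Comodule.coact (A := A) (C := C) l := by
  intro m hm
  refine hC.exists_of_map_eq_zero _ _ ?_
  rw [f.comm, LinearMap.mem_ker.1 hm, map_zero]

/-- Images of comodule morphisms are comodules. -/
theorem ComodHom.exists_image (hC : LeftFlat A C) (f : ComodHom A C M N) :
    ∃ (K : RComod A C) (ι : ComodHom A C K.carrier N), Function.Injective ι.lin ∧
      LinearMap.range ι.lin = LinearMap.range f.lin :=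
  letI := Comodule.restrict hC _ (range_stable f)
  ⟨RComod.of A C (LinearMap.range f.lin), ComodHom.restrictSubtype hC _ (range_stable f),
    Submodule.injective_subtype _, Submodule.range_subtype _⟩

/-- Kernels of comodule morphisms are comodules. -/
theorem ComodHom.exists_ker (hC : LeftFlat A C) (f : ComodHom A C M N) :
    ∃ (K : RComod A C) (ι : ComodHom A C K.carrier M), Function.Injective ι.lin ∧
      LinearMap.range ι.lin = LinearMap.ker f.lin :=
  letI := Comodule.restrict hC _ (ker_stable hC f)
  ⟨RComod.of A C (LinearMap.ker f.lin), ComodHom.restrictSubtype hC _ (ker_stable hC f),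
    Submodule.injective_subtype _, Submodule.range_subtype _⟩

/-- The inverse of a bijective comodule morphism. -/
noncomputable def ComodHom.inverse (f : ComodHom A C M N) (hf : Function.Bijective f.lin) :
    ComodHom A C N M :=
  ⟨(LinearEquiv.ofBijective f.lin hf).symm.toLinearMap, fun n => by
    obtain ⟨m, rfl⟩ := hf.2 n
    rw [← f.comm, BTensor.map_map]
    have h : (LinearEquiv.ofBijective f.lin hf).symm.toLinearMap.comp f.lin = LinearMap.id :=
      LinearMap.ext (LinearEquiv.ofBijective f.lin hf).symm_apply_apply
    rw [h]
    refine (BTensor.map_id_id _).trans (congrArg _ ?_)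
    exact ((LinearEquiv.ofBijective f.lin hf).symm_apply_apply m).symm⟩

/-- A bijective comodule morphism as an isomorphism of comodules. -/
noncomputable def RComod.isoOfBijective {M N : RComod A C} (f : ComodHom A C M.carrier N.carrier)
    (hf : Function.Bijective f.lin) : M ≅ N where
  hom := f
  inv := f.inverse hf
  hom_inv_id := ComodHom.ext (LinearEquiv.ofBijective f.lin hf).symm_apply_apply
  inv_hom_id := ComodHom.ext (LinearEquiv.ofBijective f.lin hf).apply_symm_apply

variable {Y Z : RComod A C}

theorem RComod.hom_ext {f g : Y ⟶ Z}
    (h : ∀ y, ComodHom.lin (M := Y.carrier) (N := Z.carrier) f y =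
      ComodHom.lin (M := Y.carrier) (N := Z.carrier) g y) : f = g :=
  ComodHom.ext (M := Y.carrier) (N := Z.carrier) h

theorem RComod.isIso_iff (f : Y ⟶ Z) : IsIso f ↔
    Function.Bijective (ComodHom.lin (M := Y.carrier) (N := Z.carrier) f) := by
  refine ⟨fun h => Function.bijective_iff_has_inverse.2
    ⟨ComodHom.lin (M := Z.carrier) (N := Y.carrier) (inv f), fun m => ?_, fun m => ?_⟩,
    fun h => (RComod.isoOfBijective f h).isIso_hom⟩
  · exact LinearMap.congr_fun (congrArg (ComodHom.lin (M := Y.carrier) (N := Y.carrier))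
      (IsIso.hom_inv_id f)) m
  · exact LinearMap.congr_fun (congrArg (ComodHom.lin (M := Z.carrier) (N := Z.carrier))
      (IsIso.inv_hom_id f)) m

theorem RComod.epi_of_surjective (f : Y ⟶ Z)
    (hf : Function.Surjective (ComodHom.lin (M := Y.carrier) (N := Z.carrier) f)) : Epi f where
  left_cancellation {W} _ _ hgh := ComodHom.ext (M := Z.carrier) (N := W.carrier) fun z => by
    obtain ⟨y, rfl⟩ := hf z
    exact LinearMap.congr_fun (congrArg (ComodHom.lin (M := Y.carrier) (N := W.carrier)) hgh) y

theorem RComod.mono_of_injective (f : Y ⟶ Z)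
    (hf : Function.Injective (ComodHom.lin (M := Y.carrier) (N := Z.carrier) f)) : Mono f where
  right_cancellation {W} _ _ hgh := ComodHom.ext (M := W.carrier) (N := Y.carrier) fun w =>
    hf (LinearMap.congr_fun
      (congrArg (ComodHom.lin (M := W.carrier) (N := Z.carrier)) hgh) w)

/-- The kernel is a comodule because `C` is flat. Its inclusion and the zero map agree after `f`, so
cancelling `f` makes the kernel zero. -/
theorem RComod.injective_of_mono (hC : LeftFlat A C) (f : Y ⟶ Z) [Mono f] :
    Function.Injective (ComodHom.lin (M := Y.carrier) (N := Z.carrier) f) := by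
  obtain ⟨K, ι, hι, hr⟩ :=
    ComodHom.exists_ker hC (M := Y.carrier) (N := Z.carrier) f
  have hz : ι = 0 := (cancel_mono (Z := K) (g := ι) (h := (0 : ComodHom A C K.carrier Y.carrier))
      f).1 <| ComodHom.ext (M := K.carrier) (N := Z.carrier) fun k => by
    have hk : ι.lin k ∈ LinearMap.range ι.lin := ⟨k, rfl⟩
    rw [hr] at hk
    exact (LinearMap.mem_ker.1 hk).trans
      (map_zero (ComodHom.lin (M := Y.carrier) (N := Z.carrier) f)).symm
  rw [← LinearMap.ker_eq_bot, ← hr, LinearMap.range_eq_bot]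
  exact congrArg (ComodHom.lin (M := K.carrier) (N := Y.carrier)) hz

end Subcomodules

/-! ### The adjunction and its unit and counit. -/

section UnitCounit

variable {A B C S : Type u} [Ring A] [Ring B] [AddCommGroup C] [Module A C] [Module Aᵐᵒᵖ C]
  [SMulCommClass A Aᵐᵒᵖ C] [Coring A C] [AddCommGroup S] [Module B S] [Module Aᵐᵒᵖ S]
  [SMulCommClass B Aᵐᵒᵖ S] [Comodule A C S] [LeftLinear A C B S]
  {X Y M N : Type u} [AddCommGroup X] [Module Bᵐᵒᵖ X] [AddCommGroup Y] [Module Bᵐᵒᵖ Y]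
  [AddCommGroup M] [Module Aᵐᵒᵖ M] [Comodule A C M]
  [AddCommGroup N] [Module Aᵐᵒᵖ N] [Comodule A C N]

variable (A C) in
/-- The comodule morphism `u ↦ x ⊗ u`. -/
def ComodHom.tmul (S : Type u) [AddCommGroup S] [Module B S] [Module Aᵐᵒᵖ S]
    [SMulCommClass B Aᵐᵒᵖ S] [Comodule A C S] [LeftLinear A C B S] (x : X) :
    ComodHom A C S (BTensor B X S) :=
  ⟨BTensor.tmulHom x, fun s => (tensorCoact_tmul x s).symm⟩

@[simp] theorem ComodHom.tmul_lin (x : X) (s : S) :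
    (ComodHom.tmul A C S x).lin s = BTensor.tmul B x s := rfl

variable (A B C S) in
/-- The unit `X → Hom(S, X ⊗ S)`. -/
def unitHom (X : Type u) [AddCommGroup X] [Module Bᵐᵒᵖ X] :
    X →ₗ[Bᵐᵒᵖ] ComodHom A C S (BTensor B X S) where
  toFun x := ComodHom.tmul A C S x
  map_add' x y := ComodHom.ext fun s => BTensor.add_tmul B x y s
  map_smul' b x := ComodHom.ext fun s => BTensor.smul_tmul B b.unop x s

@[simp] theorem unitHom_lin (x : X) (s : S) :
    (unitHom A B C S X x).lin s = BTensor.tmul B x s := rfl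

variable (A C B S) in
/-- The evaluation `Hom(S, M) ⊗ S → M`. -/
def evalAdd (M : Type u) [AddCommGroup M] [Module Aᵐᵒᵖ M] [Comodule A C M] :
    BTensor B (ComodHom A C S M) S →+ M :=
  BTensor.lift
    (AddMonoidHom.mk' (fun g => g.lin.toAddMonoidHom) (fun _ _ => rfl)) (fun _ _ _ => rfl)

@[simp] theorem evalAdd_tmul (g : ComodHom A C S M) (s : S) :
    evalAdd A B C S M (BTensor.tmul B g s) = g.lin s := rfl

variable (A C B S) in
/-- The counit `Hom(S, M) ⊗ S → M`. -/
def evalHom (M : Type u) [AddCommGroup M] [Module Aᵐᵒᵖ M] [Comodule A C M] :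
    ComodHom A C (BTensor B (ComodHom A C S M) S) M :=
  ⟨{ toFun := evalAdd A B C S M
     map_add' := map_add _
     map_smul' := fun a z => by
      induction z using BTensor.induction_on with
      | h0 => simp
      | ht g s => simp
      | ha x y hx hy => simp only [smul_add, map_add, hx, hy] }, fun z => by
    change BTensor.map _ LinearMap.id (tensorCoact A C B (ComodHom A C S M) S z) =
      Comodule.coact (A := A) (C := C) (evalAdd A B C S M z)
    induction z using BTensor.induction_on with
    | h0 => simp
    | ht g s =>
      rw [tensorCoact_tmul, BTensor.map_map]
      exact g.comm s
    | ha x y hx hy => simp only [map_add, hx, hy]⟩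

@[simp] theorem evalHom_tmul (g : ComodHom A C S M) (s : S) :
    (evalHom A B C S M).lin (BTensor.tmul B g s) = g.lin s := rfl

/-- This triangle identity also makes `η_X ⊗ S` bijective whenever the counit at `X ⊗ S` is. -/
theorem evalHom_tensor_unitHom (z : BTensor B X S) :
    (evalHom A B C S (BTensor B X S)).lin
      (BTensor.map (unitHom A B C S X) LinearMap.id z) = z := by
  induction z using BTensor.induction_on with
  | h0 => simp
  | ht x s => simp
  | ha x y hx hy => simp only [map_add, hx, hy]

theorem evalHom_naturality (f : ComodHom A C M N)
    (F : ComodHom A C S M →ₗ[Bᵐᵒᵖ] ComodHom A C S N) (hF : ∀ g, F g = f.comp g)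
    (z : BTensor B (ComodHom A C S M) S) :
    (evalHom A B C S N).lin (BTensor.map F LinearMap.id z) =
      f.lin ((evalHom A B C S M).lin z) := by
  induction z using BTensor.induction_on with
  | h0 => simp
  | ht g s => simp [hF]
  | ha x y hx hy => simp only [map_add, hx, hy]

variable (A B C S) in
/-- The adjunction between `- ⊗ S` and `Hom(S, -)`. -/
def tensorHomAdjunction : tensorFunctor A C B S ⊣ homFunctor A C B S :=
  Adjunction.mkOfUnitCounit
    { unit :=
        { app := fun X => ModuleCat.ofHom (unitHom A B C S X)
          naturality := fun _ _ _ => rfl }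
      counit :=
        { app := fun M => evalHom A B C S M.carrier
          naturality := fun M N f => RComod.hom_ext
            (evalHom_naturality (M := M.carrier) (N := N.carrier) f _ fun _ => rfl) }
      left_triangle := by
        ext X
        exact RComod.hom_ext evalHom_tensor_unitHom
      right_triangle := by
        ext M
        rfl }

/-- The functors are inverse equivalences exactly if the unit and counit are bijective. -/
theorem areInverseEquivalences_iff :
    AreInverseEquivalences (tensorFunctor A C B S) (homFunctor A C B S) ↔
      (∀ (X : Type u) [AddCommGroup X] [Module Bᵐᵒᵖ X], Function.Bijective (unitHom A B C S X)) ∧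
      ∀ (M : Type u) [AddCommGroup M] [Module Aᵐᵒᵖ M] [Comodule A C M],
        Function.Bijective (evalHom A B C S M).lin := by
  let adj := tensorHomAdjunction A B C S
  constructor
  -- The isomorphisms `e` and `e'` are arbitrary, but they make both functors equivalences; the unit
  -- and counit of any adjunction between equivalences are then isomorphisms.
  · rintro ⟨⟨e⟩, ⟨e'⟩⟩
    have : (tensorFunctor A C B S).IsEquivalence :=
      (CategoryTheory.Equivalence.mk _ _ e.symm e').isEquivalence_functor
    have : (homFunctor A C B S).IsEquivalence :=
      (CategoryTheory.Equivalence.mk _ _ e.symm e').isEquivalence_inverse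
    refine ⟨fun X _ _ => ?_, fun M _ _ _ => ?_⟩
    · exact ConcreteCategory.bijective_of_isIso (adj.unit.app (ModuleCat.of Bᵐᵒᵖ X))
    · exact (RComod.isIso_iff (adj.counit.app (RComod.of A C M))).1 inferInstance
  · rintro ⟨h, h'⟩
    have h1 : ∀ X, IsIso (adj.unit.app X) := fun X =>
      (ConcreteCategory.isIso_iff_bijective (adj.unit.app X)).2 (h X)
    have h2 : ∀ M, IsIso (adj.counit.app M) := fun M =>
      (RComod.isIso_iff (adj.counit.app M)).2 (h' M.carrier)
    have := NatIso.isIso_of_isIso_app adj.unit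
    have := NatIso.isIso_of_isIso_app adj.counit
    exact ⟨⟨(asIso adj.unit).symm⟩, ⟨asIso adj.counit⟩⟩

end UnitCounit

/-! ### The right `B`-modules `Hom_A(S, M)` and dual bases. -/

section RightHom

/-- Right `A`-linear maps from a `B`-`A`-bimodule, as a right `B`-module. -/
def AHom (A S M : Type*) [Ring A] [AddCommGroup S] [Module Aᵐᵒᵖ S] [AddCommGroup M]
    [Module Aᵐᵒᵖ M] : Type _ := S →ₗ[Aᵐᵒᵖ] M

variable {A B S M N : Type*} [Ring A] [Ring B] [AddCommGroup S] [Module Aᵐᵒᵖ S]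
  [AddCommGroup M] [Module Aᵐᵒᵖ M] [AddCommGroup N] [Module Aᵐᵒᵖ N]

instance : AddCommGroup (AHom A S M) := inferInstanceAs (AddCommGroup (S →ₗ[Aᵐᵒᵖ] M))

/-- The underlying linear map. -/
def AHom.lin (f : AHom A S M) : S →ₗ[Aᵐᵒᵖ] M := f

theorem AHom.ext {f g : AHom A S M} (h : ∀ s, f.lin s = g.lin s) : f = g := LinearMap.ext h

theorem AHom.add_lin (f g : AHom A S M) : (f + g).lin = f.lin + g.lin := rfl

theorem AHom.sum_lin {ι : Type*} (t : Finset ι) (f : ι → AHom A S M) (s : S) :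
    (∑ i ∈ t, f i).lin s = ∑ i ∈ t, (f i).lin s :=
  LinearMap.sum_apply t f s

variable [Module B S] [SMulCommClass B Aᵐᵒᵖ S]

instance AHom.rightModule : Module Bᵐᵒᵖ (AHom A S M) where
  smul b f := (f.lin.comp (BTensor.lmul S b.unop) : S →ₗ[Aᵐᵒᵖ] M)
  one_smul f := AHom.ext fun m => by
    change f.lin ((1 : B) • m) = _
    rw [one_smul]
  mul_smul s t f := AHom.ext fun m => by
    change f.lin ((t.unop * s.unop) • m) = f.lin (t.unop • s.unop • m)
    rw [mul_smul]
  smul_zero _ := AHom.ext fun _ => rfl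
  smul_add _ _ _ := AHom.ext fun _ => rfl
  add_smul s t f := AHom.ext fun m => by
    change f.lin ((s.unop + t.unop) • m) = f.lin (s.unop • m) + f.lin (t.unop • m)
    rw [add_smul, map_add]
  zero_smul f := AHom.ext fun m => by
    change f.lin ((0 : B) • m) = 0
    rw [zero_smul, map_zero]

variable (B S) in
/-- Postcomposition with `f`. -/
def AHom.postcomp (f : M →ₗ[Aᵐᵒᵖ] N) : AHom A S M →ₗ[Bᵐᵒᵖ] AHom A S N where
  toFun g := (f.comp g.lin : S →ₗ[Aᵐᵒᵖ] N)
  map_add' _ _ := AHom.ext fun _ => map_add f _ _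
  map_smul' _ _ := AHom.ext fun _ => rfl

variable (B S) in
/-- The map `f ↦ m * f(-)`. -/
def RDual.scale (m : M) : RDual A S →ₗ[Bᵐᵒᵖ] AHom A S M where
  toFun f := ({ toFun := fun s => op (f.lin s) • m
                map_add' := fun a b => by rw [map_add, MulOpposite.op_add, add_smul]
                map_smul' := fun a s => by
                  rw [map_smul, RingHom.id_apply, ← mul_smul]
                  rfl } : S →ₗ[Aᵐᵒᵖ] M)
  map_add' f g := AHom.ext fun s => by
    change op (f.lin s + g.lin s) • m = op (f.lin s) • m + op (g.lin s) • m
    rw [MulOpposite.op_add, add_smul]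
  map_smul' _ _ := AHom.ext fun _ => rfl

@[simp] theorem RDual.scale_lin (m : M) (f : RDual A S) (s : S) :
    (RDual.scale B S m f).lin s = op (f.lin s) • m := rfl

variable (A S) in
/-- Dual bases of a finitely generated projective right module. -/
theorem exists_dualBasis [Module.Finite Aᵐᵒᵖ S] [Module.Projective Aᵐᵒᵖ S] :
    ∃ (n : ℕ) (e : Fin n → S) (f : Fin n → RDual A S), ∀ s, ∑ i, op ((f i).lin s) • e i = s := by
  -- `S` is a retract of a finite free module: the images of the unit vectors under `p` and the
  -- coordinates of `g` form the dual basis.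
  obtain ⟨n, p, g, -, -, h⟩ := Module.Finite.exists_comp_eq_id_of_projective Aᵐᵒᵖ S
  refine ⟨n, fun i => p (Pi.single i 1), fun i =>
    ({ toFun := fun s => unop (g s i)
       map_add' := fun a b => by simp
       map_smul' := fun a s => by simp } : S →ₗ[Aᵐᵒᵖ] A), fun s => ?_⟩
  conv_rhs => rw [← show p (g s) = s from LinearMap.congr_fun h s, pi_eq_sum_univ' (g s), map_sum]
  refine Finset.sum_congr rfl fun i _ => ?_
  rw [← map_smul]
  congr 1

end RightHom

/-! ### The canonical map with coefficients in a right `A`-module. -/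

section CanAt

variable {A B C S : Type*} [Ring A] [Ring B] [AddCommGroup C] [Module A C] [Module Aᵐᵒᵖ C]
  [SMulCommClass A Aᵐᵒᵖ C] [Coring A C] [AddCommGroup S] [Module B S] [Module Aᵐᵒᵖ S]
  [SMulCommClass B Aᵐᵒᵖ S] [Comodule A C S] [LeftLinear A C B S]
  {M N : Type*} [AddCommGroup M] [Module Aᵐᵒᵖ M] [AddCommGroup N] [Module Aᵐᵒᵖ N]

variable (A C B S) in
/-- The map `Hom_A(S, M) ⊗ S → M ⊗ C`, `g ⊗ u ↦ g(u₀) ⊗ u₁`. -/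
def canAt (M : Type*) [AddCommGroup M] [Module Aᵐᵒᵖ M] :
    BTensor B (AHom A S M) S →+ BTensor A M C :=
  BTensor.lift
    (AddMonoidHom.mk' (fun g => (BTensor.map g.lin LinearMap.id).comp
        (Comodule.coact (A := A) (C := C) (M := S)).toAddMonoidHom)
      (fun f g => by
        ext u
        simp [AHom.add_lin, BTensor.map_add_left]))
    (fun f b u => by
      have h : AHom.lin (op b • f) = f.lin.comp (BTensor.lmul S b) := rfl
      simp [h, LeftLinear.coact_smul, BTensor.smul_def, BTensor.map_map])

@[simp] theorem canAt_tmul (g : AHom A S M) (s : S) :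
    canAt A B C S M (BTensor.tmul B g s) =
      BTensor.map g.lin LinearMap.id (Comodule.coact (A := A) (C := C) s) := rfl

@[simp] theorem canMap_tmul (g : RDual A S) (s : S) :
    canMap A C B S (BTensor.tmul B g s) = BTensor.lid
      (BTensor.map g.lin LinearMap.id (Comodule.coact (A := A) (C := C) s)) := rfl

theorem canAt_naturality (f : M →ₗ[Aᵐᵒᵖ] N) (z : BTensor B (AHom A S M) S) :
    canAt A B C S N (BTensor.map (AHom.postcomp B S f) LinearMap.id z) =
      BTensor.map f LinearMap.id (canAt A B C S M z) := by
  induction z using BTensor.induction_on with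
  | h0 => simp
  | ht g s =>
    rw [BTensor.map_tmul, canAt_tmul, canAt_tmul, BTensor.map_map]
    rfl
  | ha x y hx hy => simp only [map_add, hx, hy]

/-- Balancing over `A` gives `m f(u₀) ⊗ u₁ = m ⊗ f(u₀) u₁`. This is the bridge from `can` to
arbitrary coefficients. -/
theorem canAt_scale (m : M) (z : BTensor B (RDual A S) S) :
    canAt A B C S M (BTensor.map (RDual.scale B S m) LinearMap.id z) =
      BTensor.tmul A m (canMap A C B S z) := by
  induction z using BTensor.induction_on with
  | h0 => simp
  | ht f s =>
    rw [BTensor.map_tmul, canAt_tmul, canMap_tmul]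
    induction Comodule.coact (A := A) (C := C) s using BTensor.induction_on with
    | h0 => simp
    | ht t c => simp [BTensor.smul_tmul]
    | ha x y hx hy => simp only [map_add, BTensor.tmul_add, hx, hy]
  | ha x y hx hy => simp only [map_add, BTensor.tmul_add, hx, hy]

theorem canAt_surjective (h : Function.Surjective (canMap A C B S)) :
    Function.Surjective (canAt A B C S M) := by
  intro z
  induction z using BTensor.induction_on with
  | h0 => exact ⟨0, map_zero _⟩
  | ht m c =>
    obtain ⟨w, rfl⟩ := h c
    exact ⟨_, canAt_scale m w⟩
  | ha x y hx hy =>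
    obtain ⟨x, rfl⟩ := hx
    obtain ⟨y, rfl⟩ := hy
    exact ⟨x + y, map_add _ _ _⟩

variable (B S) in
/-- The left action of `A` on the dual. -/
def RDual.leftMul (a : A) : RDual A S →ₗ[Bᵐᵒᵖ] RDual A S where
  toFun f := ({ toFun := fun s => a * f.lin s
                map_add' := fun x y => by rw [map_add, mul_add]
                map_smul' := fun r s => by
                  rw [map_smul, RingHom.id_apply]
                  exact (mul_assoc a (f.lin s) r.unop).symm } : S →ₗ[Aᵐᵒᵖ] A)
  map_add' _ _ := RDual.ext fun _ => mul_add _ _ _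
  map_smul' _ _ := RDual.ext fun _ => rfl

@[simp] theorem RDual.leftMul_lin (a : A) (f : RDual A S) (s : S) :
    (RDual.leftMul B S a f).lin s = a * f.lin s := rfl

/-- Left `A`-linearity of `can` is what makes the inverse constructed in `canAt_bijective` balanced.
-/
theorem canMap_leftMul (a : A) (z : BTensor B (RDual A S) S) :
    canMap A C B S (BTensor.map (RDual.leftMul B S a) LinearMap.id z) =
      a • canMap A C B S z := by
  induction z using BTensor.induction_on with
  | h0 => simp
  | ht f s =>
    rw [BTensor.map_tmul, canMap_tmul, canMap_tmul]
    induction Comodule.coact (A := A) (C := C) s using BTensor.induction_on with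
    | h0 => simp
    | ht t c => simp [mul_smul]
    | ha x y hx hy => simp only [map_add, smul_add] at hx hy ⊢; rw [hx, hy]
  | ha x y hx hy => simp only [map_add, smul_add, hx, hy]

/-- Morally `canAt` is `M ⊗_A can`, since `Hom_A(S, M) ≅ M ⊗_A S*`. Surjectivity being known, a left
inverse `m ⊗ c ↦ m · can⁻¹(c)` suffices. -/
theorem canAt_bijective [Module.Finite Aᵐᵒᵖ S] [Module.Projective Aᵐᵒᵖ S]
    (h : Function.Bijective (canMap A C B S)) : Function.Bijective (canAt A B C S M) := by
  refine ⟨?_, canAt_surjective h.2⟩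
  let e := AddEquiv.ofBijective _ h
  have he : ∀ (a : A) (c : C), e.symm (a • c) =
      BTensor.map (RDual.leftMul B S a) LinearMap.id (e.symm c) := by
    intro a c
    apply e.injective
    rw [e.apply_symm_apply]
    refine Eq.trans ?_ (canMap_leftMul a _).symm
    congr 1
    exact (e.apply_symm_apply c).symm
  let inv : BTensor A M C →+ BTensor B (AHom A S M) S :=
    BTensor.lift
      (AddMonoidHom.mk' (fun m => (BTensor.map (RDual.scale B S m) LinearMap.id).comp
        e.symm.toAddMonoidHom) (fun m m' => by
          ext c
          have hs : RDual.scale B S (m + m') =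
              RDual.scale (A := A) B S m + RDual.scale B S m' :=
            LinearMap.ext fun f => AHom.ext fun s => smul_add _ _ _
          simp [hs, BTensor.map_add_left]))
      (fun m a c => by
        have hs : RDual.scale B S (op a • m) =
            (RDual.scale (A := A) B S m).comp (RDual.leftMul B S a) :=
          LinearMap.ext fun f => AHom.ext fun s => by simp [mul_smul]
        simp [he, BTensor.map_map, hs])
  have hinv : ∀ z, inv (canAt A B C S M z) = z := by
    intro z
    induction z using BTensor.induction_on with
    | h0 => simp
    | ht g s =>
      obtain ⟨n, b, f, hb⟩ := exists_dualBasis A S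
      -- The dual basis reduces `g` to maps of the form `m f(-)`, for which `canAt_scale` computes
      -- the image.
      have hg : g = ∑ i, RDual.scale B S (g.lin (b i)) (f i) := by
        refine AHom.ext fun s => ?_
        conv_lhs => rw [← hb s]
        simp [AHom.sum_lin]
      rw [hg, BTensor.sum_tmul, map_sum, map_sum]
      refine Finset.sum_congr rfl fun i _ => ?_
      have h1 := canAt_scale (C := C) (g.lin (b i)) (BTensor.tmul B (f i) s)
      rw [BTensor.map_tmul, LinearMap.id_apply] at h1
      rw [h1]
      change BTensor.map (RDual.scale B S _) LinearMap.id (e.symm (e _)) = _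
      rw [e.symm_apply_apply]
      rfl
    | ha x y hx hy => simp only [map_add, hx, hy]
  exact Function.LeftInverse.injective hinv

end CanAt

/-! ### Right linearity of `A ⊗ C ≅ C`. -/

section LidRight

variable {A C P : Type*} [Ring A] [AddCommGroup C] [Module A C] [Module Aᵐᵒᵖ C]
  [SMulCommClass A Aᵐᵒᵖ C] [AddCommGroup P] [Module Aᵐᵒᵖ P]

variable (A C) in
/-- `BTensor.lid` as a right linear map. -/
def lidRight : BTensor A A C →ₗ[Aᵐᵒᵖ] C where
  toFun := BTensor.lid
  map_add' := map_add _
  map_smul' a z := by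
    induction z using BTensor.induction_on with
    | h0 => simp
    | ht m n => simp [smul_comm]
    | ha x y hx hy => simp only [smul_add, map_add, hx, hy]

theorem map_lidRight (f : P →ₗ[Aᵐᵒᵖ] A) (w : BTensor A (BTensor A P C) C) :
    BTensor.map ((lidRight A C).comp (BTensor.mapRight f)) LinearMap.id w =
      BTensor.lid (BTensor.map f LinearMap.id (BTensor.assoc w)) := by
  induction w using BTensor.induction_on with
  | h0 => simp
  | ht z c =>
    induction z using BTensor.induction_on with
    | h0 => simp
    | ht s d =>
      simp only [BTensor.map_tmul, BTensor.assoc_tmul, LinearMap.id_apply, BTensor.lid_tmul,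
        BTensor.smul_tmul_left]
      congr 1
    | ha x y hx hy => simp only [BTensor.add_tmul, map_add, hx, hy]
  | ha x y hx hy => simp only [map_add, hx, hy]

end LidRight

/-! ### From `can` and `φ` to counits and units. -/

section Galois

variable {A B C S : Type u} [Ring A] [Ring B] [AddCommGroup C] [Module A C] [Module Aᵐᵒᵖ C]
  [SMulCommClass A Aᵐᵒᵖ C] [Coring A C] [AddCommGroup S] [Module B S] [Module Aᵐᵒᵖ S]
  [SMulCommClass B Aᵐᵒᵖ S] [Comodule A C S] [LeftLinear A C B S]
  {X M : Type u} [AddCommGroup X] [Module Bᵐᵒᵖ X]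
  [AddCommGroup M] [Module Aᵐᵒᵖ M] [Comodule A C M]
  {P : Type u} [AddCommGroup P] [Module Aᵐᵒᵖ P]

/-! ### Flat comatrix corings -/

variable (A B C S M) in
/-- Comodule morphisms among the right linear maps. -/
def ComodHom.toAHom : ComodHom A C S M →ₗ[Bᵐᵒᵖ] AHom A S M where
  toFun g := g.lin
  map_add' _ _ := rfl
  map_smul' _ _ := rfl

/-- Colinearity of the maps in `Hom_C(S, M)` yields this square. It compares `ε_M` with `canAt`,
whose bijectivity follows from that of `can`. -/
theorem coact_evalHom (z : BTensor B (ComodHom A C S M) S) :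
    Comodule.coact (A := A) (C := C) ((evalHom A B C S M).lin z) =
      canAt A B C S M (BTensor.map (ComodHom.toAHom A B C S M) LinearMap.id z) := by
  induction z using BTensor.induction_on with
  | h0 => simp
  | ht g s => exact (g.comm s).symm
  | ha x y hx hy => simp only [map_add, hx, hy]

theorem coact_injective : Function.Injective (Comodule.coact (A := A) (C := C) (M := M)) :=
  Function.LeftInverse.injective
    (g := fun z => BTensor.rid (BTensor.map LinearMap.id (Coring.counit (A := A) (C := C)).left z))
    Comodule.counit

variable (A B C S) in
/-- The map `g ↦ (g ⊗ C) ∘ ρ`. -/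
def AHom.coextend (M : Type u) [AddCommGroup M] [Module Aᵐᵒᵖ M] :
    AHom A S M →ₗ[Bᵐᵒᵖ] AHom A S (BTensor A M C) where
  toFun g := ((BTensor.mapRight g.lin).comp (Comodule.coact (A := A) (C := C) (M := S)) :
    S →ₗ[Aᵐᵒᵖ] BTensor A M C)
  map_add' f g := AHom.ext fun s => BTensor.map_add_left f.lin g.lin LinearMap.id _
  map_smul' b g := AHom.ext fun s => by
    change BTensor.map (g.lin.comp (BTensor.lmul S b.unop)) LinearMap.id
      (Comodule.coact (A := A) (C := C) s) =
      BTensor.map g.lin LinearMap.id (Comodule.coact (A := A) (C := C) (b.unop • s))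
    rw [LeftLinear.coact_smul, BTensor.smul_def, BTensor.map_map]
    rfl

/-- By coassociativity of `S`, the map `g ↦ (g ⊗ C) ∘ ρ` corresponds under `canAt` to `P ⊗ Δ`. -/
theorem assoc_canAt_coextend (z : BTensor B (AHom A S P) S) :
    BTensor.assoc (canAt A B C S (BTensor A P C)
      (BTensor.map (AHom.coextend A B C S P) LinearMap.id z)) =
      BTensor.map LinearMap.id (Coring.comul (A := A) (C := C)).left (canAt A B C S P z) := by
  induction z using BTensor.induction_on with
  | h0 => simp
  | ht g s =>
    have h := BTensor.map_map (Comodule.coact (A := A) (C := C) (M := S)) (LinearMap.id : C →ₗ[A] C)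
      (BTensor.mapRight (T := A) (N := C) g.lin) LinearMap.id
      (Comodule.coact (A := A) (C := C) s)
    rw [BTensor.map_tmul, canAt_tmul, canAt_tmul, BTensor.map_map, LinearMap.id_apply]
    refine (congrArg BTensor.assoc h.symm).trans ?_
    rw [BTensor.assoc_map, Comodule.coassoc, BTensor.map_map]
    rfl
  | ha x y hx hy => simp only [map_add, hx, hy]

/-- A coring that is isomorphic to a flat comatrix coring is flat. -/
theorem LeftFlat.coring [Module.Finite Aᵐᵒᵖ S] [Module.Projective Aᵐᵒᵖ S] (hS : LeftFlat B S)
    (hcan : Function.Bijective (canMap A C B S)) : LeftFlat A C := by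
  intro P Q _ _ _ _ f hf z w hzw
  -- Through `canAt`, the functor `- ⊗_A C` becomes `Hom_A(S, -) ⊗_B S`, a left exact functor
  -- followed by an exact one.
  obtain ⟨z, rfl⟩ := (canAt_bijective hcan).2 z
  obtain ⟨w, rfl⟩ := (canAt_bijective hcan).2 w
  rw [← canAt_naturality, ← canAt_naturality] at hzw
  congr 1
  refine hS _ _ (AHom.postcomp B S f) (fun g h hgh => AHom.ext fun s => hf ?_)
    ((canAt_bijective hcan).1 hzw)
  exact LinearMap.congr_fun (congrArg AHom.lin hgh) s

/-- Injectivity: `Hom_C(S, M) ⊗ S` embeds in `Hom_A(S, M) ⊗ S ≅ M ⊗ C` by flatness, compatibly with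
`ε_M` and the coaction. Surjectivity: the kernel of the map `D` below is `Hom_C(S, M)`, and flatness
preserves this kernel. -/
theorem evalHom_bijective_of_flat [Module.Finite Aᵐᵒᵖ S] [Module.Projective Aᵐᵒᵖ S]
    (hS : LeftFlat B S) (hcan : Function.Bijective (canMap A C B S)) :
    Function.Bijective (evalHom A B C S M).lin := by
  constructor
  · intro z w hzw
    refine hS _ _ (ComodHom.toAHom A B C S M) (fun g h hgh => ComodHom.ext fun s =>
      LinearMap.congr_fun (congrArg AHom.lin hgh) s) ((canAt_bijective (C := C) hcan).1 ?_)
    rw [← coact_evalHom, ← coact_evalHom, hzw]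
  · intro m
    obtain ⟨z, hz⟩ := (canAt_bijective hcan).2 (Comodule.coact (A := A) (C := C) m)
    let D : AHom A S M →ₗ[Bᵐᵒᵖ] AHom A S (BTensor A M C) :=
      AHom.postcomp B S (Comodule.coact (A := A) (C := C) (M := M)) - AHom.coextend A B C S M
    -- Under `canAt`, `D ⊗ S` becomes `ρ_M ⊗ C - M ⊗ Δ`, which kills `ρ(m)` by coassociativity.
    obtain ⟨w, hw⟩ := hS.exists_of_map_eq_zero D z (by
      refine (canAt_bijective hcan).1 (BTensor.assoc_bijective.1 ?_)
      rw [BTensor.map_sub_left, map_sub, map_sub, assoc_canAt_coextend, canAt_naturality, hz,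
        Comodule.coassoc, sub_self, map_zero, map_zero])
    let toHom : LinearMap.ker D →ₗ[Bᵐᵒᵖ] ComodHom A C S M :=
      { toFun := fun g => ⟨g.1, fun s => (sub_eq_zero.1
          (LinearMap.congr_fun (congrArg AHom.lin (LinearMap.mem_ker.1 g.2)) s)).symm⟩
        map_add' := fun _ _ => rfl
        map_smul' := fun _ _ => rfl }
    refine ⟨BTensor.map toHom LinearMap.id w, coact_injective (A := A) (C := C) ?_⟩
    rw [coact_evalHom, ← hz, ← hw, BTensor.map_map]
    rfl

/-! ### Generators -/

/-- If every map `S → Q` factored through a monomorphism `i` into `Q`, then `i` would contain the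
image of `ε_Q`, that is, all of `Q`. Being injective as well by flatness, `i` would be an
isomorphism. -/
theorem isGenerator_of_evalHom_surjective (hC : LeftFlat A C)
    (h : ∀ (M : Type u) [AddCommGroup M] [Module Aᵐᵒᵖ M] [Comodule A C M],
      Function.Surjective (evalHom A B C S M).lin) : IsGenerator (RComod.of A C S) := by
  intro P Q i _ hi
  by_contra! hv
  refine hi ((RComod.isIso_iff i).2 ⟨RComod.injective_of_mono hC i, fun q => ?_⟩)
  obtain ⟨z, rfl⟩ := h Q.carrier q
  induction z using BTensor.induction_on with
  | h0 => exact ⟨0, by rw [map_zero, map_zero]⟩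
  | ht g s =>
    obtain ⟨w, hw⟩ := hv g
    exact ⟨ComodHom.lin (M := S) (N := P.carrier) w s,
      LinearMap.congr_fun (congrArg (ComodHom.lin (M := S) (N := Q.carrier)) hw) s⟩
  | ha x y hx hy =>
    obtain ⟨a, ha⟩ := hx
    obtain ⟨b, hb⟩ := hy
    exact ⟨a + b, by rw [map_add, map_add, ha, hb]⟩

/-- Every map `S → M` factors through the image of `ε_M`, a subcomodule because `C` is flat, so this
image cannot be proper. -/
theorem evalHom_surjective_of_isGenerator (hC : LeftFlat A C)
    (h : IsGenerator (RComod.of A C S)) : Function.Surjective (evalHom A B C S M).lin := by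
  obtain ⟨K, ι, hι, hr⟩ := (evalHom A B C S M).exists_image hC
  have : Mono (show K ⟶ RComod.of A C M from ι) := RComod.mono_of_injective _ hι
  by_contra hs
  obtain ⟨v, hv⟩ := h (show K ⟶ RComod.of A C M from ι) (fun hi => hs (by
    rw [← LinearMap.range_eq_top, ← hr, LinearMap.range_eq_top]
    exact ((RComod.isIso_iff _).1 hi).2))
  refine hv ?_
  have hle : LinearMap.range (ComodHom.lin (M := S) (N := M) v) ≤ LinearMap.range ι.lin := by
    rintro _ ⟨s, rfl⟩
    rw [hr]
    exact ⟨BTensor.tmul B (show ComodHom A C S M from v) s, rfl⟩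
  exact ComodHom.exists_lift hC ι hι v hle

/-- If all counits are surjective and all units at the modules `Hom(S, M)` are surjective,
the counits are injective. -/
theorem evalHom_injective_of_surjective (hC : LeftFlat A C)
    (h : ∀ (M : Type u) [AddCommGroup M] [Module Aᵐᵒᵖ M] [Comodule A C M],
      Function.Surjective (evalHom A B C S M).lin)
    (hη : Function.Surjective (unitHom A B C S (ComodHom A C S M))) :
    Function.Injective (evalHom A B C S M).lin := by
  obtain ⟨K, ι, hι, hr⟩ := (evalHom A B C S M).exists_ker hC
  -- A map from `S` to `K = ker ε_M` becomes `u ↦ f ⊗ u` in `Hom_C(S, M) ⊗ S` since the unit is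
  -- surjective. Evaluating gives `f u = 0`. So `Hom_C(S, K) = 0`, and surjectivity of `ε_K` leaves
  -- `K = 0`.
  have hK : ∀ g : ComodHom A C S K.carrier, g = 0 := by
    intro g
    obtain ⟨f, hf⟩ := hη (ι.comp g)
    have hf0 : f = 0 := ComodHom.ext fun s => by
      have h1 : ι.lin (g.lin s) ∈ LinearMap.range ι.lin := ⟨_, rfl⟩
      rw [hr, LinearMap.mem_ker] at h1
      have h2 : (ι.comp g).lin s = BTensor.tmul B f s := by rw [← hf]; rfl
      rw [ComodHom.comp_lin] at h2
      rw [h2] at h1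
      exact h1
    rw [hf0, map_zero] at hf
    exact ComodHom.ext fun s => hι <|
      (LinearMap.congr_fun (congrArg ComodHom.lin hf.symm) s).trans (map_zero ι.lin).symm
  rw [← LinearMap.ker_eq_bot, ← hr, LinearMap.range_eq_bot]
  ext k
  obtain ⟨z, rfl⟩ := h K.carrier k
  have hz : z = 0 := by
    induction z using BTensor.induction_on with
    | h0 => rfl
    | ht g s => rw [hK g, BTensor.zero_tmul]
    | ha x y hx hy => rw [hx, hy, add_zero]
  rw [hz]
  simp

/-! ### The maps `can` and `φ` -/

theorem lid_map_left {K Q : Type*} [AddCommGroup K] [Module A K] [AddCommGroup Q] [Module A Q]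
    (f : P →ₗ[Aᵐᵒᵖ] A) (g : K →ₗ[A] Q) (z : BTensor A P K) :
    BTensor.lid (BTensor.map f g z) = g (BTensor.lid (BTensor.map f LinearMap.id z)) := by
  induction z using BTensor.induction_on with
  | h0 => simp
  | ht m p => simp
  | ha x y hx hy => simp only [map_add, hx, hy]

theorem lid_map_counit (f : P →ₗ[Aᵐᵒᵖ] A) (z : BTensor A P C) :
    (Coring.counit (A := A) (C := C)).left (BTensor.lid (BTensor.map f LinearMap.id z)) =
      f (BTensor.rid (BTensor.map LinearMap.id (Coring.counit (A := A) (C := C)).left z)) := by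
  induction z using BTensor.induction_on with
  | h0 => simp
  | ht m p => simp
  | ha x y hx hy => simp only [map_add, hx, hy]

variable (A B C S) in
/-- The map `S* → Hom_C(S, C)`, `f ↦ (f ⊗ C) ∘ ρ`. -/
def RDual.cohom : RDual A S →ₗ[Bᵐᵒᵖ] ComodHom A C S C where
  toFun f :=
    ⟨((lidRight A C).comp (BTensor.mapRight f.lin)).comp
      (Comodule.coact (A := A) (C := C) (M := S)), fun s => by
      have h := BTensor.map_map (Comodule.coact (A := A) (C := C) (M := S))
        (LinearMap.id : C →ₗ[A] C)
        ((lidRight A C).comp (BTensor.mapRight (T := A) (N := C) f.lin)) LinearMap.id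
        (Comodule.coact (A := A) (C := C) s)
      refine h.symm.trans ?_
      rw [map_lidRight, Comodule.coassoc, BTensor.map_map]
      exact lid_map_left f.lin (Coring.comul (A := A) (C := C)).left _⟩
  map_add' f g := ComodHom.ext fun s => by
    change BTensor.lid (BTensor.map (f.lin + g.lin) LinearMap.id _) = _
    rw [BTensor.map_add_left, map_add]
    rfl
  map_smul' b f := ComodHom.ext fun s => by
    change BTensor.lid (BTensor.map (f.lin.comp (BTensor.lmul S b.unop)) LinearMap.id
      (Comodule.coact (A := A) (C := C) s)) = BTensor.lid (BTensor.map f.lin LinearMap.id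
        (Comodule.coact (A := A) (C := C) (b.unop • s)))
    rw [LeftLinear.coact_smul, BTensor.smul_def, BTensor.map_map]
    rfl

theorem RDual.cohom_lin (f : RDual A S) (s : S) :
    (RDual.cohom A B C S f).lin s = BTensor.lid (BTensor.map f.lin LinearMap.id
      (Comodule.coact (A := A) (C := C) s)) := rfl

/-- Composing with the counit of `C` inverts the map: `C` is the cofree comodule on `A`. -/
theorem RDual.cohom_bijective : Function.Bijective (RDual.cohom A B C S) := by
  constructor
  · intro f g hfg
    refine RDual.ext fun s => ?_
    have h : (Coring.counit (A := A) (C := C)).left ((cohom A B C S f).lin s) =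
        (Coring.counit (A := A) (C := C)).left ((cohom A B C S g).lin s) := by rw [hfg]
    rwa [cohom_lin, cohom_lin, lid_map_counit, lid_map_counit, Comodule.counit] at h
  · intro g
    let f : RDual A S := ((Coring.counit (A := A) (C := C)).right.comp g.lin : S →ₗ[Aᵐᵒᵖ] A)
    refine ⟨f, ComodHom.ext fun s => ?_⟩
    rw [cohom_lin]
    have h := Coring.counit_left (A := A) (g.lin s)
    have h2 : (Coring.comul (A := A) (C := C)).left (g.lin s) = _ := (g.comm s).symm
    rw [h2, BTensor.map_map] at h
    exact h

theorem evalHom_cohom (z : BTensor B (RDual A S) S) :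
    (evalHom A B C S C).lin (BTensor.map (RDual.cohom A B C S) LinearMap.id z) =
      canMap A C B S z := by
  induction z using BTensor.induction_on with
  | h0 => simp
  | ht f s => rfl
  | ha x y hx hy => simp only [map_add, hx, hy]

/-- `can` is `ε_C` preceded by the isomorphism `S* ⊗ S ≅ Hom_C(S, C) ⊗ S`. -/
theorem canMap_bijective_iff :
    Function.Bijective (canMap A C B S) ↔ Function.Bijective (evalHom A B C S C).lin := by
  rw [← (BTensor.map_bijective_of_bijective (N := S)
    (RDual.cohom_bijective (A := A) (B := B) (C := C) (S := S))).of_comp_iff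
    (evalHom A B C S C).lin]
  exact iff_of_eq (congrArg Function.Bijective (funext fun z => (evalHom_cohom z).symm))

theorem canMap_surjective (h : Function.Surjective (evalHom A B C S C).lin) :
    Function.Surjective (canMap A C B S) := by
  have h2 := h.comp (BTensor.map_bijective_of_bijective (N := S)
    (RDual.cohom_bijective (A := A) (B := B) (C := C) (S := S))).2
  rwa [show _ ∘ _ = _ from funext evalHom_cohom] at h2

variable (A B C S) in
/-- The comodule isomorphism `B ⊗ S → S`. -/
def lidHom : ComodHom A C (BTensor B B S) S :=
  ⟨{ toFun := BTensor.lid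
     map_add' := map_add _
     map_smul' := fun a z => by
      induction z using BTensor.induction_on with
      | h0 => simp
      | ht m n => simp [smul_comm]
      | ha x y hx hy => simp only [smul_add, map_add, hx, hy] }, fun z => by
    change BTensor.map _ LinearMap.id (tensorCoact A C B B S z) =
      Comodule.coact (A := A) (C := C) (BTensor.lid z)
    induction z using BTensor.induction_on with
    | h0 => simp
    | ht b s =>
      rw [tensorCoact_tmul, BTensor.map_map, BTensor.lid_tmul, LeftLinear.coact_smul (A := A)]
      change _ = BTensor.map (BTensor.lmul S b) LinearMap.id _
      congr 2
    | ha x y hx hy => simp only [map_add, hx, hy]⟩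

theorem lidHom_bijective : Function.Bijective (lidHom A B C S).lin := BTensor.lid_bijective

/-- `φ` is `η_B` followed by composition with the comodule isomorphism `B ⊗ S ≅ S`. -/
theorem actionHom_bijective_iff : Function.Bijective (actionHom A C B S) ↔
    Function.Bijective (unitHom A B C S B) := by
  have hL := lidHom_bijective (A := A) (B := B) (C := C) (S := S)
  let L : ComodHom A C S (BTensor B B S) → ComodHom A C S S := (lidHom A B C S).comp
  have hb : Function.Bijective L := by
    refine ⟨fun f g h => ComodHom.ext fun s => hL.1
      (LinearMap.congr_fun (congrArg ComodHom.lin h) s), fun g => ?_⟩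
    exact ⟨((lidHom A B C S).inverse hL).comp g, ComodHom.ext fun s =>
      (LinearEquiv.ofBijective (lidHom A B C S).lin hL).apply_symm_apply _⟩
  rw [← hb.of_comp_iff']
  refine iff_of_eq (congrArg Function.Bijective (funext fun b => ComodHom.ext fun s => ?_))
  exact (BTensor.lid_tmul b s).symm

end Galois

/-! ### Units for a projective comodule. -/

section ProjectiveUnit

variable {A B C S : Type u} [Ring A] [Ring B] [AddCommGroup C] [Module A C] [Module Aᵐᵒᵖ C]
  [SMulCommClass A Aᵐᵒᵖ C] [Coring A C] [AddCommGroup S] [Module B S] [Module Aᵐᵒᵖ S]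
  [SMulCommClass B Aᵐᵒᵖ S] [Comodule A C S] [LeftLinear A C B S]
  {X M N : Type u} [AddCommGroup X] [Module Bᵐᵒᵖ X]
  [AddCommGroup M] [Module Aᵐᵒᵖ M] [Comodule A C M]
  [AddCommGroup N] [Module Aᵐᵒᵖ N] [Comodule A C N]

-- Replacing the target by the image of `f`, a comodule as `C` is flat, turns `f` into an
-- epimorphism through which projectivity can lift.
omit [Module B S] [SMulCommClass B Aᵐᵒᵖ S] [LeftLinear A C B S] in
theorem ComodHom.exists_lift_of_projective (hC : LeftFlat A C)
    (hS : Projective (RComod.of A C S)) (f : ComodHom A C M N) (g : ComodHom A C S N)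
    (hfg : LinearMap.range g.lin ≤ LinearMap.range f.lin) :
    ∃ g' : ComodHom A C S M, f.comp g' = g := by
  obtain ⟨K, ι, hι, hr⟩ := f.exists_image hC
  obtain ⟨p, hp⟩ := ComodHom.exists_lift hC ι hι f hr.ge
  obtain ⟨q, hq⟩ := ComodHom.exists_lift hC ι hι g (hfg.trans hr.ge)
  have : Epi (show RComod.of A C M ⟶ K from p) := RComod.epi_of_surjective _ fun k => by
    obtain ⟨m, hm⟩ : ι.lin k ∈ LinearMap.range f.lin := hr ▸ ⟨k, rfl⟩
    exact ⟨m, hι (by rw [← hm, ← hp]; rfl)⟩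
  obtain ⟨g', hg'⟩ := hS.factors (show RComod.of A C S ⟶ K from q)
    (show RComod.of A C M ⟶ K from p)
  refine ⟨g', ComodHom.ext fun s => ?_⟩
  rw [← hq, ← hp, ← show ComodHom.comp p g' = q from hg']
  rfl

/-- The unit is bijective at free modules. -/
theorem unitHom_free_bijective [Module.Finite Aᵐᵒᵖ S] (ι : Type u)
    (hφ : Function.Bijective (actionHom A C B S)) :
    Function.Bijective (unitHom A B C S (ι →₀ B)) := by
  classical
  let π (i : ι) : (ι →₀ B) →ₗ[Bᵐᵒᵖ] B := Finsupp.lapply i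
  constructor
  · refine (injective_iff_map_eq_zero _).2 fun x hx => Finsupp.ext fun i => hφ.1 ?_
    rw [Finsupp.zero_apply, map_zero]
    refine ComodHom.ext (M := S) (N := S) fun s => ?_
    have h : BTensor.tmul B x s = 0 := LinearMap.congr_fun (congrArg ComodHom.lin hx) s
    have h2 : BTensor.lid (BTensor.map (π i) LinearMap.id (BTensor.tmul B x s)) = x i • s := by
      rw [BTensor.map_tmul, BTensor.lid_tmul]
      rfl
    rw [h, map_zero, map_zero] at h2
    exact h2.symm
  · intro g
    let gi (i : ι) : ComodHom A C S S :=
      (lidHom A B C S).comp ((ComodHom.tensor A C S (π i)).comp g)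
    have hgi : ∀ i s, (gi i).lin s =
      BTensor.lid (BTensor.map (π i) LinearMap.id (g.lin s)) := fun _ _ => rfl
    -- Each coordinate of `g` is a comodule endomorphism of `S`, hence multiplication by some `b i`.
    choose b hb using fun i => hφ.2 (gi i)
    have hb' : ∀ i s, b i • s = (gi i).lin s := fun i s =>
      LinearMap.congr_fun (congrArg (ComodHom.lin (M := S) (N := S)) (hb i)) s
    obtain ⟨G, hG⟩ := Module.Finite.fg_top (R := Aᵐᵒᵖ) (M := S)
    choose t ht using fun s => BTensor.exists_finset_coordinates_eq_zero (g.lin s)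
    -- An index outside the supports of `g` at the finitely many generators has a zero coordinate
    -- map, so `b i = 0`.
    have hfin : ∀ i, b i ≠ 0 → i ∈ G.biUnion t := by
      intro i hi
      by_contra h
      refine hi (hφ.1 ?_)
      rw [hb, map_zero]
      refine Subtype.ext (LinearMap.ext_on hG fun s hs => ?_)
      exact ht s i fun hit => h (Finset.mem_biUnion.2 ⟨s, hs, hit⟩)
    refine ⟨Finsupp.onFinset _ b hfin, ComodHom.ext fun s =>
      BTensor.ext_leftCoordinates fun i => ?_⟩
    rw [unitHom_lin, BTensor.map_tmul, BTensor.lid_tmul]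
    exact (hb' i s).trans (hgi i s)

variable (B X) in
/-- The free cover of a right module. -/
noncomputable def freeCover : (X →₀ B) →ₗ[Bᵐᵒᵖ] X :=
  Finsupp.lsum ℕ fun x =>
    { toFun := fun b => op b • x
      map_add' := fun a b => by rw [MulOpposite.op_add, add_smul]
      map_smul' := fun a b => by simp [mul_smul] }

theorem freeCover_single (x : X) : freeCover B X (Finsupp.single x 1) = x := by
  simp [freeCover]

/-- The unit is bijective if `S` is a finitely generated projective comodule and `φ` is
bijective. -/
theorem unitHom_bijective_of_projective [Module.Finite Aᵐᵒᵖ S] (hC : LeftFlat A C)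
    (hS : Projective (RComod.of A C S)) (hφ : Function.Bijective (actionHom A C B S)) :
    Function.Bijective (unitHom A B C S X) := by
  let p := freeCover B X
  have hp : Function.Surjective p := fun x => ⟨_, freeCover_single x⟩
  constructor
  · refine (injective_iff_map_eq_zero _).2 fun x hx => ?_
    let y : X →₀ B := Finsupp.single x 1
    have hy : p y = x := freeCover_single x
    let q := (LinearMap.ker p).subtype.comp (freeCover B (LinearMap.ker p))
    -- Here `q` maps a free module onto `ker p`. As `η(x) = 0`, right exactness puts the values of
    -- `η(y)` in the image of `q ⊗ S`. The lift `g` is itself a unit value `η(z)`, so `y = q z` lies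
    -- in `ker p` and `x = p y = 0`.
    obtain ⟨g, hg⟩ := ComodHom.exists_lift_of_projective hC hS (ComodHom.tensor A C S q)
      (unitHom A B C S _ y) (by
        rintro _ ⟨s, rfl⟩
        obtain ⟨w, hw⟩ := BTensor.exists_of_map_eq_zero_of_surjective hp (BTensor.tmul B y s) (by
          rw [BTensor.map_tmul, hy]
          exact LinearMap.congr_fun (congrArg ComodHom.lin hx) s)
        obtain ⟨v, rfl⟩ := BTensor.map_surjective (N := S) (g := LinearMap.id)
          (f := freeCover B (LinearMap.ker p)) (fun x => ⟨_, freeCover_single x⟩)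
          Function.surjective_id w
        refine ⟨v, Eq.trans ?_ hw⟩
        rw [BTensor.map_map]
        rfl)
    obtain ⟨z, rfl⟩ := (unitHom_free_bijective _ hφ).2 g
    have e : unitHom A B C S (X →₀ B) (q z) = unitHom A B C S (X →₀ B) y := by
      rw [← hg]
      exact ComodHom.ext (A := A) (C := C) (M := S) (N := BTensor B (X →₀ B) S) fun _ => rfl
    have h : q z = y := (unitHom_free_bijective _ hφ).1 e
    rw [← hy, ← h]
    exact (freeCover B (LinearMap.ker p) z).2
  · intro g
    obtain ⟨g', rfl⟩ := ComodHom.exists_lift_of_projective hC hS (ComodHom.tensor A C S p) g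
      (by
        rintro _ ⟨s, rfl⟩
        exact BTensor.map_surjective hp Function.surjective_id _)
    obtain ⟨y, rfl⟩ := (unitHom_free_bijective _ hφ).2 g'
    exact ⟨p y, rfl⟩

end ProjectiveUnit

/-! ### The natural retraction of coactions over a coseparable coring. -/

section Coseparable

variable {A B C S : Type u} [Ring A] [Ring B] [AddCommGroup C] [Module A C] [Module Aᵐᵒᵖ C]
  [SMulCommClass A Aᵐᵒᵖ C] [Coring A C]
  {X M N P : Type u} [AddCommGroup X] [Module Bᵐᵒᵖ X]
  [AddCommGroup M] [Module Aᵐᵒᵖ M] [Comodule A C M]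
  [AddCommGroup N] [Module Aᵐᵒᵖ N] [Comodule A C N]
  [AddCommGroup P] [Module Aᵐᵒᵖ P]

/-- A bicomodule retraction of the comultiplication. -/
structure IsCoseparator (π : BimodHom A A (BTensor A C C) C) : Prop where
  right_colinear : π.right ∈ comodHom A C (BTensor A C C) C
  left_colinear : ∀ z : BTensor A C C, BTensor.map LinearMap.id π.left
      (BTensor.assoc (BTensor.map (Coring.comul (A := A) (C := C)).right LinearMap.id z)) =
    (Coring.comul (A := A) (C := C)).left (π.left z)
  retract : ∀ c : C, π.left ((Coring.comul (A := A) (C := C)).left c) = c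

/-- The cointegral `ε ∘ π`. -/
def cointegral (π : BimodHom A A (BTensor A C C) C) : BTensor A C C →ₗ[A] A :=
  (Coring.counit (A := A) (C := C)).left.comp π.left

theorem cointegral_op_smul (π : BimodHom A A (BTensor A C C) C) (a : Aᵐᵒᵖ) (z : BTensor A C C) :
    cointegral π (a • z) = cointegral π z * a.unop := by
  change Coring.counit.left (π.left (a • z)) = _
  rw [π.map_op_smul, BimodHom.map_op_smul]
  rfl

/-- The map `c ↦ m * δ(d ⊗ c)` for `z = m ⊗ d`. -/
def contract (π : BimodHom A A (BTensor A C C) C) (z : BTensor A P C) : C →ₗ[Aᵐᵒᵖ] P where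
  toFun c := BTensor.rid (BTensor.map LinearMap.id
    ((cointegral π).comp (BTensor.tmulFlip c)) z)
  map_add' c d := by
    induction z using BTensor.induction_on with
    | h0 => simp
    | ht m c' => simp [BTensor.tmul_add]
    | ha x y hx hy => simp only [map_add, hx, hy]; abel
  map_smul' a c := by
    induction z using BTensor.induction_on with
    | h0 => simp
    | ht m c' =>
      simp only [BTensor.map_tmul, BTensor.rid_tmul, LinearMap.comp_apply,
        BTensor.tmulFlip_apply, LinearMap.id_apply, ← BTensor.op_smul_tmul, cointegral_op_smul,
        MulOpposite.op_mul, MulOpposite.op_unop, mul_smul, RingHom.id_apply]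
    | ha x y hx hy => simp only [map_add, smul_add, hx, hy]

theorem contract_apply (π : BimodHom A A (BTensor A C C) C) (z : BTensor A P C) (c : C) :
    contract π z c = BTensor.rid (BTensor.map LinearMap.id
      ((cointegral π).comp (BTensor.tmulFlip c)) z) := rfl

theorem contract_add (π : BimodHom A A (BTensor A C C) C) (z w : BTensor A P C) :
    contract π (z + w) = contract π z + contract π w :=
  LinearMap.ext fun c => by simp [contract_apply]

/-- Right colinearity reads `π(c ⊗ d₁) ⊗ d₂ = Δ(π(c ⊗ d))`; applying the counit to the left factor
gives `δ(c ⊗ d₁) d₂ = π(c ⊗ d)`. -/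
theorem IsCoseparator.map_contract {π : BimodHom A A (BTensor A C C) C} (h : IsCoseparator π)
    (z : BTensor A P C) (d : C) :
    BTensor.map (contract π z) LinearMap.id (Coring.comul (A := A) (C := C).left d) =
      BTensor.map LinearMap.id (π.left.comp (BTensor.tmulFlip d)) z := by
  induction z using BTensor.induction_on with
  | h0 =>
    rw [map_zero]
    exact BTensor.map_zero_left _ _
  | ht m c =>
    have key : ∀ y : BTensor A C C, BTensor.map (contract π (BTensor.tmul A m c)) LinearMap.id y =
        BTensor.tmul A m (BTensor.lid (BTensor.map (Coring.counit (A := A) (C := C)).right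
          LinearMap.id (BTensor.map π.right (LinearMap.id : C →ₗ[A] C)
            (BTensor.map (BTensor.tmulHom (T := A) c) LinearMap.id y)))) := by
      intro y
      induction y using BTensor.induction_on with
      | h0 => simp
      | ht c' d' =>
        simp only [BTensor.map_tmul, contract_apply, BTensor.rid_tmul, BTensor.lid_tmul,
          LinearMap.id_apply, LinearMap.comp_apply, BTensor.tmulFlip_apply,
          BTensor.tmulHom_apply, ← BTensor.smul_tmul]
        rfl
      | ha x y hx hy => simp only [map_add, BTensor.tmul_add, hx, hy]
    have h1 := h.right_colinear (BTensor.tmul A c d)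
    rw [key]
    refine congrArg (BTensor.tmul A m) (Eq.trans (congrArg (fun z => BTensor.lid
      (BTensor.map (Coring.counit (A := A) (C := C)).right LinearMap.id z)) ?_)
      (Coring.counit_left (A := A) (π.left (BTensor.tmul A c d))))
    exact (congrArg _ (tensorCoact_tmul c d).symm).trans h1
  | ha x y hx hy => rw [contract_add, BTensor.map_add_left, hx, hy, map_add]


/-- The left linear map `c ⊗ d ↦ c * f(d)`. -/
def sliceRight (f : C →ₗ[A] A) : BTensor A C C →ₗ[A] C where
  toFun y := BTensor.rid (BTensor.map LinearMap.id f y)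
  map_add' x y := by simp only [map_add]
  map_smul' a y := by
    induction y using BTensor.induction_on with
    | h0 => simp
    | ht c d => simp [smul_comm]
    | ha x y hx hy => simp only [smul_add, map_add, hx, hy]

omit [Coring A C] in
theorem sliceRight_apply (f : C →ₗ[A] A) (y : BTensor A C C) :
    sliceRight f y = BTensor.rid (BTensor.map LinearMap.id f y) := rfl

omit [Coring A C] in
theorem rid_map_assoc (f : C →ₗ[A] A) (w : BTensor A (BTensor A P C) C) :
    BTensor.rid (BTensor.map LinearMap.id f w) =
      BTensor.map LinearMap.id (sliceRight f) (BTensor.assoc w) := by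
  induction w using BTensor.induction_on with
  | h0 => simp
  | ht z c =>
    induction z using BTensor.induction_on with
    | h0 => simp
    | ht s d => simp [sliceRight_apply]
    | ha x y hx hy => simp only [BTensor.add_tmul, map_add, hx, hy]
  | ha x y hx hy => simp only [map_add, hx, hy]

/-- The mirror image: left colinearity and the counit on the right factor give `c₁ δ(c₂ ⊗ d) = π(c ⊗
d)`. -/
theorem IsCoseparator.sliceRight_comul {π : BimodHom A A (BTensor A C C) C}
    (h : IsCoseparator π) (c d : C) :
    sliceRight ((cointegral π).comp (BTensor.tmulFlip d))
      ((Coring.comul (A := A) (C := C)).left c) = π.left (BTensor.tmul A c d) := by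
  have h1 := h.left_colinear (BTensor.tmul A c d)
  have h2 := Coring.counit_right (A := A) (π.left (BTensor.tmul A c d))
  rw [← h1, BTensor.map_map] at h2
  rw [sliceRight_apply, ← h2, BTensor.map_tmul]
  change _ = BTensor.rid (BTensor.map _ _ (BTensor.map LinearMap.id (BTensor.tmulFlip d) _))
  rw [BTensor.map_map]
  rfl

/-- By coassociativity the coaction of `m₀ δ(m₁ ⊗ d)` is `m₀ ⊗ m₁ δ(m₂ ⊗ d)`, to which
`sliceRight_comul` applies. -/
theorem IsCoseparator.coact_contract {π : BimodHom A A (BTensor A C C) C} (h : IsCoseparator π)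
    (m : M) (d : C) :
    Comodule.coact (A := A) (C := C) (contract π (Comodule.coact (A := A) (C := C) m) d) =
      BTensor.map LinearMap.id (π.left.comp (BTensor.tmulFlip d))
        (Comodule.coact (A := A) (C := C) m) := by
  have h1 : (sliceRight ((cointegral π).comp (BTensor.tmulFlip d))).comp
      (Coring.comul (A := A) (C := C)).left = π.left.comp (BTensor.tmulFlip d) :=
    LinearMap.ext fun c => h.sliceRight_comul c d
  rw [contract_apply, ← BTensor.rid_map, BTensor.map_map, ← h1]
  have h2 := BTensor.map_map (Comodule.coact (A := A) (C := C) (M := M)) (LinearMap.id : C →ₗ[A] C)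
    LinearMap.id ((cointegral π).comp (BTensor.tmulFlip d)) (Comodule.coact (A := A) (C := C) m)
  refine (congrArg BTensor.rid h2.symm).trans ?_
  rw [rid_map_assoc, Comodule.coassoc, BTensor.map_map]
  rfl

theorem rid_map_cointegral_assoc (π : BimodHom A A (BTensor A C C) C) (z : BTensor A P C) (c : C) :
    BTensor.rid (BTensor.map LinearMap.id (cointegral π) (BTensor.assoc (BTensor.tmul A z c))) =
      contract π z c :=
  congrArg BTensor.rid (BTensor.map_map LinearMap.id (BTensor.tmulFlip c) LinearMap.id
    (cointegral π) z)

variable (M) in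
/-- The linear map `M ⊗ C → M`, `m ⊗ c ↦ m₀ * δ(m₁ ⊗ c)`. -/
def contractCoact (π : BimodHom A A (BTensor A C C) C) : BTensor A M C →ₗ[Aᵐᵒᵖ] M where
  toFun v := BTensor.rid (BTensor.map LinearMap.id (cointegral π)
    (BTensor.assoc (BTensor.map (Comodule.coact (A := A) (C := C)) LinearMap.id v)))
  map_add' v w := by simp only [map_add]
  map_smul' a v := by
    induction v using BTensor.induction_on with
    | h0 => simp
    | ht m c =>
      rw [BTensor.op_smul_tmul, BTensor.map_tmul, BTensor.map_tmul, rid_map_cointegral_assoc,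
        rid_map_cointegral_assoc]
      exact (contract π _).map_smul a c
    | ha x y hx hy => simp only [smul_add, map_add, hx, hy]

theorem contractCoact_apply (π : BimodHom A A (BTensor A C C) C) (v : BTensor A M C) :
    contractCoact M π v = BTensor.rid (BTensor.map LinearMap.id (cointegral π)
      (BTensor.assoc (BTensor.map (Comodule.coact (A := A) (C := C)) LinearMap.id v))) := rfl

theorem contractCoact_tmul (π : BimodHom A A (BTensor A C C) C) (m : M) (c : C) :
    contractCoact M π (BTensor.tmul A m c) =
      contract π (Comodule.coact (A := A) (C := C) m) c := by
  rw [contractCoact_apply, BTensor.map_tmul, rid_map_cointegral_assoc]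
  rfl

/-- The natural colinear retraction `M ⊗ C → M` of the coaction. -/
def IsCoseparator.retraction {π : BimodHom A A (BTensor A C C) C} (h : IsCoseparator π)
    (M : Type u) [AddCommGroup M] [Module Aᵐᵒᵖ M] [Comodule A C M] :
    ComodHom A C (BTensor A M C) M :=
  ⟨contractCoact M π, fun v => by
    induction v using BTensor.induction_on with
    | h0 => simp
    | ht m c =>
      have h1 : (contractCoact M π).comp (BTensor.tmulHom m) =
          contract π (Comodule.coact (A := A) (C := C) m) :=
        LinearMap.ext fun c => contractCoact_tmul π m c
      -- Both sides equal `m₀ ⊗ π(m₁ ⊗ c)`, one by left and the other by right colinearity of `π`.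
      rw [contractCoact_tmul, h.coact_contract, ← h.map_contract, ← h1]
      exact (congrArg _ (tensorCoact_tmul m c)).trans (BTensor.map_map _ _ _ _ _)
    | ha x y hx hy => simp only [map_add, hx, hy]⟩

theorem IsCoseparator.retraction_lin {π : BimodHom A A (BTensor A C C) C} (h : IsCoseparator π) :
    (h.retraction M).lin = contractCoact M π := rfl

/-- Coassociativity turns `m₀ δ(m₁ ⊗ m₂)` into `m₀ δ(Δ(m₁))`. Since `π ∘ Δ = id`, `δ ∘ Δ` is the
counit. -/
theorem IsCoseparator.retraction_coact {π : BimodHom A A (BTensor A C C) C} (h : IsCoseparator π)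
    (m : M) : (h.retraction M).lin (Comodule.coact (A := A) (C := C) m) = m := by
  rw [h.retraction_lin, contractCoact_apply, Comodule.coassoc, BTensor.map_map]
  have h1 : (cointegral π).comp (Coring.comul (A := A) (C := C)).left =
      (Coring.counit (A := A) (C := C)).left :=
    LinearMap.ext fun c => congrArg _ (h.retract c)
  rw [h1]
  exact Comodule.counit m

theorem IsCoseparator.retraction_naturality {π : BimodHom A A (BTensor A C C) C}
    (h : IsCoseparator π) (f : ComodHom A C M N) (v : BTensor A M C) :
    (h.retraction N).lin (BTensor.map f.lin LinearMap.id v) = f.lin ((h.retraction M).lin v) := by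
  have h1 : (Comodule.coact (A := A) (C := C) (M := N)).comp f.lin =
      (BTensor.mapRight f.lin).comp (Comodule.coact (A := A) (C := C) (M := M)) :=
    LinearMap.ext fun m => (f.comm m).symm
  rw [h.retraction_lin, h.retraction_lin, contractCoact_apply, contractCoact_apply,
    BTensor.map_map, h1, ← BTensor.rid_map, BTensor.map_map]
  have h2 := BTensor.map_map (Comodule.coact (A := A) (C := C) (M := M)) (LinearMap.id : C →ₗ[A] C)
    (BTensor.mapRight (T := A) (N := C) f.lin) LinearMap.id v
  refine (congrArg (fun w => BTensor.rid (BTensor.map LinearMap.id (cointegral π)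
    (BTensor.assoc w))) h2.symm).trans ?_
  rw [BTensor.assoc_map, BTensor.map_map]
  rfl

end Coseparable

/-! ### Averaging linear maps into colinear ones. -/

section Averaging

variable {A B C S : Type u} [Ring A] [Ring B] [AddCommGroup C] [Module A C] [Module Aᵐᵒᵖ C]
  [SMulCommClass A Aᵐᵒᵖ C] [Coring A C] [AddCommGroup S] [Module B S] [Module Aᵐᵒᵖ S]
  [SMulCommClass B Aᵐᵒᵖ S] [Comodule A C S] [LeftLinear A C B S]
  {X M N P : Type u} [AddCommGroup X] [Module Bᵐᵒᵖ X]
  [AddCommGroup M] [Module Aᵐᵒᵖ M] [Comodule A C M]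
  [AddCommGroup N] [Module Aᵐᵒᵖ N] [Comodule A C N]
  [AddCommGroup P] [Module Aᵐᵒᵖ P]
  {π : BimodHom A A (BTensor A C C) C}

omit [Comodule A C M] in
theorem assoc_tensorCoact (z : BTensor A M C) : BTensor.assoc (tensorCoact A C A M C z) =
    BTensor.map LinearMap.id (Coring.comul (A := A) (C := C)).left z := by
  induction z using BTensor.induction_on with
  | h0 => simp
  | ht m c =>
    rw [tensorCoact_tmul, BTensor.map_tmul]
    change BTensor.assoc (BTensor.map _ _ ((Coring.comul (A := A) (C := C)).left c)) = _
    induction (Coring.comul (A := A) (C := C)).left c using BTensor.induction_on with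
    | h0 => simp
    | ht d e => simp
    | ha x y hx hy => simp only [map_add, BTensor.tmul_add, hx, hy]
  | ha x y hx hy => simp only [map_add, hx, hy]

variable (A C M) in
/-- The coaction as a comodule morphism. -/
def coactHom : ComodHom A C M (BTensor A M C) :=
  ⟨Comodule.coact, fun m => BTensor.assoc_bijective.1
    ((Comodule.coassoc m).trans (assoc_tensorCoact _).symm)⟩

variable (B S M) in
/-- The averaging map `Hom_A(S, M) → Hom_C(S, M)` of a coseparable coring. -/
def IsCoseparator.average (h : IsCoseparator π) : AHom A S M →ₗ[Bᵐᵒᵖ] ComodHom A C S M where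
  toFun g := (h.retraction M).comp ((ComodHom.tensor A C C g.lin).comp (coactHom A C S))
  map_add' f g := ComodHom.ext fun s => by
    change (h.retraction M).lin (BTensor.map (f.lin + g.lin) LinearMap.id _) = _
    rw [BTensor.map_add_left, map_add]
    rfl
  map_smul' b g := ComodHom.ext fun s => by
    change (h.retraction M).lin (BTensor.map (g.lin.comp (BTensor.lmul S b.unop)) LinearMap.id
      (Comodule.coact (A := A) (C := C) s)) = (h.retraction M).lin (BTensor.map g.lin LinearMap.id
        (Comodule.coact (A := A) (C := C) (b.unop • s)))
    rw [LeftLinear.coact_smul, BTensor.smul_def, BTensor.map_map]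
    rfl

theorem IsCoseparator.average_lin (h : IsCoseparator π) (g : AHom A S M) (s : S) :
    (h.average B S M g).lin s = (h.retraction M).lin (BTensor.map g.lin LinearMap.id
      (Comodule.coact (A := A) (C := C) s)) := rfl

theorem IsCoseparator.average_toAHom (h : IsCoseparator π) (g : ComodHom A C S M) :
    h.average B S M (ComodHom.toAHom A B C S M g) = g := ComodHom.ext fun s => by
  rw [h.average_lin]
  refine (congrArg _ (g.comm s)).trans (h.retraction_coact (g.lin s))

theorem IsCoseparator.average_postcomp (h : IsCoseparator π) (f : ComodHom A C M N)
    (g : AHom A S M) :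
    h.average B S N (AHom.postcomp B S f.lin g) = f.comp (h.average B S M g) :=
  ComodHom.ext fun s => by
    rw [h.average_lin, ComodHom.comp_lin, h.average_lin, ← h.retraction_naturality,
      BTensor.map_map]
    rfl

/-- Taking `z` with `canAt z = ρ(m)` gives a preimage of `m` under `ε_M`; hence surjectivity of
`can` suffices for that of `ε_M`. -/
theorem IsCoseparator.evalHom_average (h : IsCoseparator π) (z : BTensor B (AHom A S M) S) :
    (evalHom A B C S M).lin (BTensor.map (h.average B S M) LinearMap.id z) =
      (h.retraction M).lin (canAt A B C S M z) := by
  induction z using BTensor.induction_on with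
  | h0 => simp
  | ht g s => rfl
  | ha x y hx hy => simp only [map_add, hx, hy]

theorem IsCoseparator.evalHom_surjective (h : IsCoseparator π)
    (hcan : Function.Surjective (canMap A C B S)) :
    Function.Surjective (evalHom A B C S M).lin := fun m => by
  obtain ⟨z, hz⟩ := canAt_surjective hcan (Comodule.coact (A := A) (C := C) m)
  exact ⟨_, (h.evalHom_average z).trans (by rw [hz, h.retraction_coact])⟩

/-- Averaging splits the inclusion of `Hom_C(S, M)` into `Hom_A(S, M)` over `B`, so it stays
injective after tensoring with `S` even if `S` is not flat. -/
theorem IsCoseparator.evalHom_bijective [Module.Finite Aᵐᵒᵖ S] [Module.Projective Aᵐᵒᵖ S]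
    (h : IsCoseparator π) (hcan : Function.Bijective (canMap A C B S)) :
    Function.Bijective (evalHom A B C S M).lin := by
  refine ⟨fun z w hzw => ?_, h.evalHom_surjective hcan.2⟩
  have hinj : Function.Injective (BTensor.map (ComodHom.toAHom A B C S M)
      (LinearMap.id : S →ₗ[B] S)) :=
    BTensor.map_injective_of_leftInverse (h.average B S M) h.average_toAHom
  refine hinj ((canAt_bijective (C := C) hcan).1 ?_)
  rw [← coact_evalHom, ← coact_evalHom, hzw]

/-- Over a coseparable coring, the unit is bijective if `φ` is. -/
theorem IsCoseparator.unitHom_bijective [Module.Finite Aᵐᵒᵖ S] [Module.Projective Aᵐᵒᵖ S]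
    (h : IsCoseparator π) (hφ : Function.Bijective (actionHom A C B S)) :
    Function.Bijective (unitHom A B C S X) := by
  obtain ⟨n, e, f, hef⟩ := exists_dualBasis A S
  let φ : B ≃+ ComodHom A C S S := AddEquiv.ofBijective (actionHom A C B S).toAddMonoidHom hφ
  have hφ_lin : ∀ b s, (φ b).lin s = b • s := fun _ _ => rfl
  have hφ_symm : ∀ g s, φ.symm g • s = g.lin s := fun g s => by
    rw [← hφ_lin, φ.apply_symm_apply]
  have hφ_lmul : ∀ (b : B) (g : ComodHom A C S S),
      φ.symm ((ComodHom.lmul A C S b).comp g) = b * φ.symm g := fun b g => by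
    refine φ.injective (ComodHom.ext fun s => ?_)
    rw [φ.apply_symm_apply, hφ_lin, mul_smul, hφ_symm]
    rfl
  constructor
  · refine (injective_iff_map_eq_zero _).2 fun x hx => ?_
    -- The rank one map `t ↦ s f_i(t)` averages to a colinear endomorphism, that is, to an element
    -- of `B` by which `x` can be multiplied. Averaging commutes with `φ(b)`, so this is balanced.
    let r (i : Fin n) : BTensor B X S →+ X := BTensor.lift
      (AddMonoidHom.mk' (fun x => AddMonoidHom.mk'
          (fun s => op (φ.symm (h.average B S S (RDual.scale B S s (f i)))) • x)
          (fun s t => by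
            have hs : RDual.scale B S (s + t) (f i) =
                RDual.scale B S s (f i) + RDual.scale B S t (f i) :=
              AHom.ext fun _ => smul_add _ _ _
            rw [hs, map_add, map_add, MulOpposite.op_add, add_smul]))
        (fun a b => by ext s; simp))
      (fun x b s => by
        have hs : RDual.scale B S (b • s) (f i) =
            AHom.postcomp B S (ComodHom.lmul A C S b).lin (RDual.scale B S s (f i)) :=
          AHom.ext fun t => (smul_comm b (op ((f i).lin t)) s).symm
        simp only [AddMonoidHom.mk'_apply]
        rw [hs, h.average_postcomp, hφ_lmul, MulOpposite.op_mul, mul_smul])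
    have hr : ∀ i, op (φ.symm (h.average B S S (RDual.scale B S (e i) (f i)))) • x = 0 := by
      intro i
      have h1 : BTensor.tmul B x (e i) = 0 := LinearMap.congr_fun (congrArg ComodHom.lin hx) (e i)
      exact (congrArg (r i) h1).trans (map_zero _)
    -- The rank one maps of the dual basis add up to the identity, which averaging fixes; so `x` is
    -- the sum of the `r i (x ⊗ e i)`, all of them zero.
    have hid : ∑ i, RDual.scale B S (e i) (f i) =
        ComodHom.toAHom A B C S S (ComodHom.id A C S) := AHom.ext fun s => by
      rw [AHom.sum_lin]
      exact hef s
    have hone : φ.symm (ComodHom.id A C S) = 1 := by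
      rw [φ.symm_apply_eq]
      exact ComodHom.ext fun s => (one_smul B s).symm
    have hsum := Finset.sum_eq_zero fun i (_ : i ∈ Finset.univ) => hr i
    rwa [← Finset.sum_smul, ← Finset.op_sum, ← map_sum, ← map_sum, hid, h.average_toAHom,
      hone, MulOpposite.op_one, one_smul] at hsum
  · intro g
    -- Expand `g` in the dual basis and average. The values `g(e_i)` are sums of tensors `x ⊗ s`,
    -- and naturality moves `x` out of the average, leaving an endomorphism of `S`, that is, an
    -- element of `B`.
    have hg : g = ∑ i, h.average B S _ (RDual.scale B S (g.lin (e i)) (f i)) := by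
      rw [← map_sum]
      conv_lhs => rw [← h.average_toAHom (B := B) g]
      congr 1
      refine AHom.ext fun s => ?_
      rw [AHom.sum_lin]
      conv_lhs => rw [← hef s]
      exact (map_sum g.lin _ _).trans (Finset.sum_congr rfl fun i _ => map_smul _ _ _)
    have key : ∀ (i : Fin n) (z : BTensor B X S), h.average B S _ (RDual.scale B S z (f i)) ∈
        LinearMap.range (unitHom A B C S X) := by
      intro i z
      induction z using BTensor.induction_on with
      | h0 =>
        have hs : RDual.scale B S (0 : BTensor B X S) (f i) = 0 :=
          AHom.ext fun _ => smul_zero _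
        rw [hs, map_zero]
        exact zero_mem _
      | ht x s =>
        have hs : RDual.scale B S (BTensor.tmul B x s) (f i) =
            AHom.postcomp B S (ComodHom.tmul A C S x).lin (RDual.scale B S s (f i)) :=
          AHom.ext fun t => BTensor.op_smul_tmul _ _ _
        rw [hs, h.average_postcomp]
        refine ⟨op (φ.symm (h.average B S S (RDual.scale B S s (f i)))) • x,
          ComodHom.ext fun t => ?_⟩
        rw [unitHom_lin, BTensor.smul_tmul, hφ_symm]
        rfl
      | ha x y hx hy =>
        have hs : RDual.scale B S (x + y) (f i) =
            RDual.scale B S x (f i) + RDual.scale B S y (f i) :=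
          AHom.ext fun _ => smul_add _ _ _
        rw [hs, map_add]
        exact add_mem hx hy
    rw [hg]
    exact sum_mem fun i _ => key i _

end Averaging

/-! ### Consequences of an equivalence, and criteria for one. -/

section Equivalences

variable {A B C S : Type u} [Ring A] [Ring B] [AddCommGroup C] [Module A C] [Module Aᵐᵒᵖ C]
  [SMulCommClass A Aᵐᵒᵖ C] [Coring A C] [AddCommGroup S] [Module B S] [Module Aᵐᵒᵖ S]
  [SMulCommClass B Aᵐᵒᵖ S] [Comodule A C S] [LeftLinear A C B S]

/-- If the counit at `X ⊗ S` is bijective, so is `η ⊗ S` for the unit `η` at `X`. -/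
theorem map_unitHom_bijective {X : Type u} [AddCommGroup X] [Module Bᵐᵒᵖ X]
    (h : Function.Bijective (evalHom A B C S (BTensor B X S)).lin) :
    Function.Bijective (BTensor.map (unitHom A B C S X) (LinearMap.id : S →ₗ[B] S)) := by
  rw [← h.of_comp_iff']
  convert Function.bijective_id using 1
  exact funext evalHom_tensor_unitHom

/-- `S` is the image of the projective module `B`, and equivalences preserve projectives. -/
theorem AreInverseEquivalences.projective
    (h : AreInverseEquivalences (tensorFunctor A C B S) (homFunctor A C B S)) :
    Projective (RComod.of A C S) := by
  obtain ⟨⟨e⟩, ⟨e'⟩⟩ := h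
  let E := CategoryTheory.Equivalence.mk _ _ e.symm e'
  have : Module.Projective Bᵐᵒᵖ B :=
    Module.Projective.of_equiv (MulOpposite.opLinearEquiv Bᵐᵒᵖ (M := B)).symm
  have hB : Projective (ModuleCat.of Bᵐᵒᵖ B) := inferInstance
  have hF : Projective (E.functor.obj (ModuleCat.of Bᵐᵒᵖ B)) :=
    (E.map_projective_iff _).2 hB
  exact Projective.of_iso (RComod.isoOfBijective (M := RComod.of A C (BTensor B B S))
    (N := RComod.of A C S) (lidHom A B C S) lidHom_bijective) hF

/-- Equivalences preserve monomorphisms, and over a flat coring these are injective. -/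
theorem LeftFlat.of_areInverseEquivalences (hC : LeftFlat A C)
    (h : AreInverseEquivalences (tensorFunctor A C B S) (homFunctor A C B S)) :
    LeftFlat B S := by
  intro X Y _ _ _ _ f hf
  obtain ⟨⟨e⟩, ⟨e'⟩⟩ := h
  have : (tensorFunctor A C B S).IsEquivalence :=
    (CategoryTheory.Equivalence.mk _ _ e.symm e').isEquivalence_functor
  have : Mono (ModuleCat.ofHom f) := (ModuleCat.mono_iff_injective _).2 hf
  exact RComod.injective_of_mono hC ((tensorFunctor A C B S).map (ModuleCat.ofHom f))

/-- Bijective units and surjective counits give inverse equivalences. -/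
theorem areInverseEquivalences_of_surjective (hC : LeftFlat A C)
    (hη : ∀ (X : Type u) [AddCommGroup X] [Module Bᵐᵒᵖ X],
      Function.Bijective (unitHom A B C S X))
    (hε : ∀ (M : Type u) [AddCommGroup M] [Module Aᵐᵒᵖ M] [Comodule A C M],
      Function.Surjective (evalHom A B C S M).lin) :
    AreInverseEquivalences (tensorFunctor A C B S) (homFunctor A C B S) :=
  areInverseEquivalences_iff.2 ⟨hη, fun M _ _ _ =>
    ⟨evalHom_injective_of_surjective hC hε (hη _).2, hε M⟩⟩

end Equivalences

/-! ### The two lists of equivalent conditions. -/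

theorem mainTheorem10 (A B C S : Type u) [Ring A] [Ring B]
    [AddCommGroup C] [Module A C] [Module Aᵐᵒᵖ C] [SMulCommClass A Aᵐᵒᵖ C] [Coring A C]
    [AddCommGroup S] [Module B S] [Module Aᵐᵒᵖ S] [SMulCommClass B Aᵐᵒᵖ S]
    [Comodule A C S] [LeftLinear A C B S]
    [Module.Finite Aᵐᵒᵖ S] [Module.Projective Aᵐᵒᵖ S] :
    List.TFAE [
      AreInverseEquivalences (tensorFunctor A C B S) (homFunctor A C B S) ∧ LeftFlat A C,
      LeftFlat B S ∧ Projective (RComod.of A C S) ∧ Function.Bijective (canMap A C B S) ∧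
        Function.Bijective (actionHom A C B S),
      LeftFlat A C ∧ Projective (RComod.of A C S) ∧ IsGenerator (RComod.of A C S) ∧
        Function.Bijective (actionHom A C B S),
      LeftFaithfullyFlat B S ∧ Function.Bijective (canMap A C B S)] ∧
    (IsCoseparable A C → Module.Projective A C →
      List.TFAE [
        AreInverseEquivalences (tensorFunctor A C B S) (homFunctor A C B S),
        IsGenerator (RComod.of A C S) ∧ Function.Bijective (actionHom A C B S),
        Function.Bijective (actionHom A C B S) ∧ Function.Surjective (canMap A C B S),
        LeftCompletelyFaithful B S ∧ Function.Bijective (canMap A C B S)]) := by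
  constructor
  · tfae_have 1 → 2 := by
      rintro ⟨h, hC⟩
      obtain ⟨hη, hε⟩ := areInverseEquivalences_iff.1 h
      exact ⟨hC.of_areInverseEquivalences h, h.projective, canMap_bijective_iff.2 (hε C),
        actionHom_bijective_iff.2 (hη B)⟩
    tfae_have 2 → 3 := by
      rintro ⟨hS, hP, hcan, hφ⟩
      have hC := hS.coring hcan
      exact ⟨hC, hP, isGenerator_of_evalHom_surjective (B := B) hC
        fun M _ _ _ => (evalHom_bijective_of_flat hS hcan).2, hφ⟩
    tfae_have 3 → 1 := by
      rintro ⟨hC, hP, hG, hφ⟩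
      exact ⟨areInverseEquivalences_of_surjective hC
        (fun X _ _ => unitHom_bijective_of_projective hC hP hφ)
        (fun M _ _ _ => evalHom_surjective_of_isGenerator hC hG), hC⟩
    tfae_have 1 → 4 := by
      rintro ⟨h, hC⟩
      obtain ⟨hη, hε⟩ := areInverseEquivalences_iff.1 h
      refine ⟨⟨hC.of_areInverseEquivalences h, fun X _ _ hX => ?_⟩, canMap_bijective_iff.2 (hε C)⟩
      -- If `X ⊗ S = 0` then `Hom_C(S, X ⊗ S) = 0`, and `X` embeds in it through the unit.
      exact ⟨fun x y => (hη X).1 (ComodHom.ext fun s => Subsingleton.elim _ _)⟩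
    tfae_have 4 → 1 := by
      rintro ⟨hS, hcan⟩
      have hε : ∀ (M : Type u) [AddCommGroup M] [Module Aᵐᵒᵖ M] [Comodule A C M],
        Function.Bijective (evalHom A B C S M).lin :=
          fun M _ _ _ => evalHom_bijective_of_flat hS.1 hcan
      refine ⟨areInverseEquivalences_iff.2 ⟨fun X _ _ => ?_, hε⟩, hS.1.coring hcan⟩
      have h := map_unitHom_bijective (X := X) (hε (BTensor B X S))
      exact ⟨hS.injective_of_map_injective _ h.1, surjective_of_map_surjective hS.2 _ h.2⟩
    tfae_finish
  · rintro ⟨π, hr, hl, hs⟩ _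
    have hπ : IsCoseparator π := ⟨hr, hl, hs⟩
    have hC : LeftFlat A C := LeftFlat.of_projective
    tfae_have 1 → 2 := by
      intro h
      obtain ⟨hη, hε⟩ := areInverseEquivalences_iff.1 h
      exact ⟨isGenerator_of_evalHom_surjective (B := B) hC fun M _ _ _ => (hε M).2,
        actionHom_bijective_iff.2 (hη B)⟩
    tfae_have 2 → 3 := by
      rintro ⟨hG, hφ⟩
      exact ⟨hφ, canMap_surjective (evalHom_surjective_of_isGenerator hC hG)⟩
    tfae_have 3 → 1 := by
      rintro ⟨hφ, hcan⟩
      exact areInverseEquivalences_of_surjective hC (fun X _ _ => hπ.unitHom_bijective hφ)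
        fun M _ _ _ => hπ.evalHom_surjective hcan
    tfae_have 1 → 4 := by
      intro h
      obtain ⟨hη, hε⟩ := areInverseEquivalences_iff.1 h
      refine ⟨fun X _ _ x hx => ?_, canMap_bijective_iff.2 (hε C)⟩
      exact (hη X).1 (ComodHom.ext fun s => (hx s).trans (BTensor.zero_tmul s).symm)
    tfae_have 4 → 1 := by
      rintro ⟨hS, hcan⟩
      refine areInverseEquivalences_iff.2 ⟨fun X _ _ => ⟨?_, ?_⟩,
        fun M _ _ _ => hπ.evalHom_bijective hcan⟩
      -- The kernel of `η_X` is exactly the annihilator of `S` in `X`, so complete faithfulness is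
      -- injectivity of all units.
      · refine (injective_iff_map_eq_zero _).2 fun x hx => hS X x fun s => ?_
        exact LinearMap.congr_fun (congrArg ComodHom.lin hx) s
      · exact surjective_of_map_surjective (fun X _ _ hX => hS.subsingleton hX) _
          (map_unitHom_bijective (X := X) (hπ.evalHom_bijective hcan)).2
    tfae_finish
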